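/- **Theorem (Oracle inequality for random forests).** Let $(X,Y)$ be a random pair in $\mathbb{R}^p\times\mathbb{R}$ with $|Y|\le B$ almost surely, where $B>0$, let $\mu(x)=\mathbb{E}(Y\mid X=x)$, and let $\mathcal{D}_n=\{(X_1,Y_1),\dots,(X_n,Y_n)\}$ consist of $n$ independent copies of $(X,Y)$, where $np\ge 2$. Let $1\le q\le p$, $K\ge 1$, $M\ge 1$. *The forest.* A randomized tree $\widehat\mu(\Theta)=\widehat\mu(\Theta,\mathcal{D}_n)$ is built as follows. Draw a bootstrap sample (of size $n$, with replacement) from $\mathcal{D}_n$ and grow from it a regression tree of depth $K$, starting with the node $\mathbb{R}^p$. A node is no longer split if it contains a single data point, if all response values in it are equal, or if depth $K$ is reached. At every other node $\mathrm{t}$ draw, independently, a uniformly random set $\mathcal{S}\subset\{1,\dots,p\}$ of size $q$, and split $\mathrm{t}$ into $\mathrm{t}_L=\{x\in\mathrm{t}:x_j\le s\}$ and $\mathrm{t}_R=\{x\in\mathrm{t}:x_j>s\}$, where $(j,s)$ maximizes the impurity gain $$\widehat\Delta(s,j,\mathrm{t})=V(\mathrm{t})-\frac{N(\mathrm{t}_L)}{N(\mathrm{t})}V(\mathrm{t}_L)-\frac{N(\mathrm{t}_R)}{N(\mathrm{t})}V(\mathrm{t}_R)$$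 over all $j\in\mathcal{S}$ and $s\in\mathbb{R}$ for which both daughters contain data, ties being broken by an arbitrary (measurable) rule; here $N(\mathrm{t})$ is the number of points of the bootstrap sample in $\mathrm{t}$ (with multiplicity) and $V(\mathrm{t})$ is the sample variance (with divisor $N(\mathrm{t})$) of their responses. If no such $(j,s)$ exists, the node passes undivided to the next level, where a new $\mathcal{S}$ is drawn. On each terminal node the tree predicts the mean of the responses of the bootstrap sample in that node. The forest is $\widehat\mu(\boldsymbol\Theta)=M^{-1}\sum_{m=1}^M\widehat\mu(\Theta_m)$, where $\boldsymbol\Theta=(\Theta_1,\dots,\Theta_M)$ are independent copies, independent of $\mathcal{D}_n$, of the randomness $\Theta$ (bootstrap indices and sets $\mathcal{S}$). *The norms.* Let $\|f\|^2=\mathbb{E}\,f(X)^2$, with $X$ independent of $\mathcal{D}_n$ and $\boldsymbol\Theta$. Let $\mathcal{G}$ be the class of functions $g$ with $g(X)=g_1(X_1)+\cdots+g_p(X_p)$ almost surely (here $X_j$ is the $j$-th coordinate of $X$), where each $g_j$ has finite total variation $v(g_j)$ over the support of $X_j$, and let $\|g\|_{\mathrm{TV}}$ be the infimum of $v(g_1)+\cdots+v(g_p)$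 over all such representations of $g$. Then there is a constant $C>0$ that depends only on $B$ such that $$\mathbb{E}_{\boldsymbol{\Theta},\mathcal{D}_n}\big(\|\mu-\widehat\mu(\boldsymbol\Theta)\|^2\big)\le 2\inf_{g\in\mathcal{G}}\Big\{\|\mu-g\|^2+\frac{p}{q}\,\frac{\|g\|_{\mathrm{TV}}^2}{K+3}+C\,\frac{2^K\log(np)}{n}\Big\}.$$ -/

import Mathlib

open MeasureTheory

namespace RandomForest

/-! ### Additive functions of bounded variation -/

/-- The total variation `v(f)` of a univariate function over the support of the `j`-th coordinate
of a random vector with law `P`. -/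
noncomputable def coordVariation {p : ℕ} (P : Measure (Fin p → ℝ)) (j : Fin p) (f : ℝ → ℝ) :
    ENNReal :=
  eVariationOn f (P.map (fun x => x j)).support

/-- `f₁, …, f_p` is an additive representation `g(X) = f₁(X₁) + ⋯ + f_p(X_p)`, where `X ∼ P`. -/
def IsAdditiveRep {p : ℕ} (P : Measure (Fin p → ℝ)) (g : (Fin p → ℝ) → ℝ)
    (f : Fin p → ℝ → ℝ) : Prop :=
  g =ᵐ[P] fun x => ∑ j, f j (x j)

/-- The class `𝒢` of additive functions all of whose components have bounded variation over the
supports of the respective coordinates. -/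
def additiveBV {p : ℕ} (P : Measure (Fin p → ℝ)) : Set ((Fin p → ℝ) → ℝ) :=
  {g | ∃ f : Fin p → ℝ → ℝ, IsAdditiveRep P g f ∧ ∀ j, coordVariation P j (f j) ≠ ⊤}

/-- `‖g‖_TV`: the infimum of `v(f₁) + ⋯ + v(f_p)` over all additive representations of `g`
(a finite number for every `g ∈ 𝒢`). -/
noncomputable def tvNorm {p : ℕ} (P : Measure (Fin p → ℝ)) (g : (Fin p → ℝ) → ℝ) : ℝ :=
  (⨅ (f : Fin p → ℝ → ℝ) (_ : IsAdditiveRep P g f), ∑ j, coordVariation P j (f j)).toReal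

/-- `‖f‖²`, the squared norm in `L₂(P)`. -/
noncomputable def sqNorm {p : ℕ} (P : Measure (Fin p → ℝ)) (f : (Fin p → ℝ) → ℝ) : ℝ :=
  ∫ x, (f x) ^ 2 ∂P

/-! ### Nodes and impurity -/

/-- A data set of `n` pairs `(Xᵢ, Yᵢ)`. -/
abbrev Sample (n p : ℕ) : Type := Fin n → (Fin p → ℝ) × ℝ

/-- A node: a region of the predictor space. -/
abbrev Node (p : ℕ) : Type := Set (Fin p → ℝ)

/-- A split `(j, s)`: a variable and a split point. -/
abbrev Split (p : ℕ) : Type := Fin p × ℝ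

/-- The left daughter node `{x ∈ t : x_j ≤ s}`. -/
def leftNode {p : ℕ} (t : Node p) (c : Split p) : Node p := {x ∈ t | x c.1 ≤ c.2}

/-- The right daughter node `{x ∈ t : x_j > s}`. -/
def rightNode {p : ℕ} (t : Node p) (c : Split p) : Node p := {x ∈ t | c.2 < x c.1}

open Classical in
/-- The indices of the sample points that lie in the node `t`. -/
noncomputable def members {n p : ℕ} (Z : Sample n p) (t : Node p) : Finset (Fin n) :=
  {i | (Z i).1 ∈ t}

/-- `N(t)`, the number of sample points in `t`. -/
noncomputable def count {n p : ℕ} (Z : Sample n p) (t : Node p) : ℕ := (members Z t).card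

/-- The sample mean of the responses in `t`. -/
noncomputable def nodeMean {n p : ℕ} (Z : Sample n p) (t : Node p) : ℝ :=
  (∑ i ∈ members Z t, (Z i).2) / count Z t

/-- The impurity of `t`: the within-node sample variance of the responses. -/
noncomputable def impurity {n p : ℕ} (Z : Sample n p) (t : Node p) : ℝ :=
  (∑ i ∈ members Z t, ((Z i).2 - nodeMean Z t) ^ 2) / count Z t

/-- The impurity gain of the split `c = (j, s)` of the node `t`. -/
noncomputable def gain {n p : ℕ} (Z : Sample n p) (t : Node p) (c : Split p) : ℝ :=
  impurity Z t -
    ((count Z (leftNode t c) / count Z t : ℝ) * impurity Z (leftNode t c) +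
      (count Z (rightNode t c) / count Z t : ℝ) * impurity Z (rightNode t c))

/-- `c = (j, s)` is a candidate split of `t` when the variables in `S` may be used: `j ∈ S`, and
both daughter nodes contain sample points. -/
def IsCandidate {n p : ℕ} (Z : Sample n p) (t : Node p) (S : Finset (Fin p)) (c : Split p) :
    Prop :=
  c.1 ∈ S ∧ 0 < count Z (leftNode t c) ∧ 0 < count Z (rightNode t c)

/-- A way to choose a split, given the training sample, the node, and the variables that may be
used there. -/
abbrev SplitRule (n p : ℕ) : Type := Sample n p → Node p → Finset (Fin p) → Split p

/-- The rule is the CART rule with some way of breaking ties: it chooses a candidate split of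
largest impurity gain whenever there is a candidate split at all. -/
def IsCART {n p : ℕ} (rule : SplitRule n p) : Prop :=
  ∀ (Z : Sample n p) (t : Node p) (S : Finset (Fin p)), (∃ c, IsCandidate Z t S c) →
    IsCandidate Z t S (rule Z t S) ∧
      ∀ c, IsCandidate Z t S c → gain Z t c ≤ gain Z t (rule Z t S)

/-- The stopping criterion: one data point only, or all the responses in the node are equal. -/
def IsFinal {n p : ℕ} (Z : Sample n p) (t : Node p) : Prop :=
  count Z t = 1 ∨ ∀ i ∈ members Z t, ∀ i' ∈ members Z t, (Z i).2 = (Z i').2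

/-! ### The randomization -/

/-- The subsets of size `q` of the set of the `p` variables. -/
abbrev QSubset (p q : ℕ) : Type := {S : Finset (Fin p) // S.card = q}

/-- One subset of size `q` for each position in the first `K` levels of a binary tree: one for the
root, and a family of `K - 1` levels for each of the two daughters (`false` is the left one). A
uniformly distributed element consists of independent uniformly distributed subsets. -/
def Draws (p q : ℕ) : ℕ → Type
  | 0 => Unit
  | K + 1 => QSubset p q × (Bool → Draws p q K)

/-- The variables drawn at the root. -/
def Draws.root {p q K : ℕ} (ξ : Draws p q (K + 1)) : Finset (Fin p) :=
  (show QSubset p q × (Bool → Draws p q K) from ξ).1.1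

/-- The draws for the left (`false`) or the right (`true`) subtree. -/
def Draws.sub {p q K : ℕ} (ξ : Draws p q (K + 1)) (b : Bool) : Draws p q K :=
  (show QSubset p q × (Bool → Draws p q K) from ξ).2 b

noncomputable instance instFintypeDraws (p q : ℕ) : (K : ℕ) → Fintype (Draws p q K)
  | 0 => inferInstanceAs (Fintype Unit)
  | K + 1 =>
    letI := instFintypeDraws p q K
    inferInstanceAs (Fintype (QSubset p q × (Bool → Draws p q K)))

/-- The values of the random variable `Θ` that randomizes one tree: the indices of the bootstrap
sample (`n` draws with replacement) and the variables drawn at the nodes. The law of `Θ` is the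
uniform distribution on this finite type. -/
abbrev Theta (n p q K : ℕ) : Type := (Fin n → Fin n) × Draws p q K

/-! ### Trees and forests -/

open Classical in
/-- The value at `x` of the tree that is grown on `Z` from the node `t ∋ x` for at most `K` further
levels. A node for which none of the drawn variables offers a candidate split passes undivided to
the next level (where new variables are drawn). -/
noncomputable def grow {n p q : ℕ} (rule : SplitRule n p) (Z : Sample n p) :
    (K : ℕ) → Draws p q K → Node p → (Fin p → ℝ) → ℝ
  | 0, _, t, _ => nodeMean Z t
  | K + 1, ξ, t, x =>
    if IsFinal Z t then nodeMean Z t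
    else if ∃ c, IsCandidate Z t ξ.root c then
      if x (rule Z t ξ.root).1 ≤ (rule Z t ξ.root).2 then
        grow rule Z K (ξ.sub false) (leftNode t (rule Z t ξ.root)) x
      else grow rule Z K (ξ.sub true) (rightNode t (rule Z t ξ.root)) x
    else grow rule Z K (ξ.sub false) t x

/-- The output `μ̂(Θ, D)` of the depth `K` tree grown from the root on the bootstrap sample. -/
noncomputable def treeOutput {n p q K : ℕ} (rule : SplitRule n p) (θ : Theta n p q K)
    (D : Sample n p) (x : Fin p → ℝ) : ℝ :=
  grow rule (fun i => D (θ.1 i)) K θ.2 Set.univ x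

/-- The output of the random forest: the average of the outputs of its `M` trees. -/
noncomputable def forestOutput {n p q K M : ℕ} (rule : SplitRule n p)
    (Θ : Fin M → Theta n p q K) (D : Sample n p) (x : Fin p → ℝ) : ℝ :=
  (M : ℝ)⁻¹ * ∑ m, treeOutput rule (Θ m) D x

open scoped BigOperators in
/-- The expected risk `𝔼_{Θ, D} ‖μ - μ̂(Θ, D)‖²`, where `D` consists of `n` independent draws from
the law `ρ` of `(X, Y)`, and `Θ = (Θ₁, …, Θ_M)` of `M` independent uniformly distributed elements,
independent of `D`. -/
noncomputable def expectedRisk {n p : ℕ} (q K M : ℕ) (rule : SplitRule n p)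
    (ρ : Measure ((Fin p → ℝ) × ℝ)) (μ : (Fin p → ℝ) → ℝ) : ℝ :=
  𝔼 Θ : Fin M → Theta n p q K,
    ∫ D : Sample n p, sqNorm ρ.fst (fun x => μ x - forestOutput rule Θ D x)
      ∂(Measure.pi fun _ : Fin n => ρ)

/-- `μ` is (a version of) the regression function `x ↦ 𝔼(Y | X = x)` when `(X, Y) ∼ ρ`. -/
def IsRegressionFunction {p : ℕ} (ρ : Measure ((Fin p → ℝ) × ℝ)) (μ : (Fin p → ℝ) → ℝ) : Prop :=
  Measurable μ ∧
    (fun z : (Fin p → ℝ) × ℝ => μ z.1) =ᵐ[ρ]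
      condExp (MeasurableSpace.comap Prod.fst inferInstance) ρ Prod.snd

end RandomForest

namespace RandomForest

open scoped BigOperators

/-! ### Summation by parts against a function of bounded variation -/

/-! The proof joins a training bound for CART, valid on every sample with coordinates in the
supports, to a fast-rate deviation bound over a finite class of trees.

Training error. Fix additive components of total variation at most V, and a node with N points and
residuals r about the node mean. The partial sums of r along a coordinate are at most N/2 times the
square root of the best impurity gain (`four_mul_sq_le_gain`). Summation by parts therefore bounds
the excess training error of the node mean over the additive function by N V times that root. The
drawn set contains the best variable with probability q/p, so with γ = q/(pV²) one level of
splitting lowers the mean excess per point from x to at most x - γx². This map sends every x below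
1/(4γ), and 1/(γm) below 1/(γ(m+1)); hence K levels reach 1/(γ(K+3)). To pass from nodes to trees,
x² is replaced by a tangent line 2ux - u² whose u depends on the level only: the estimate becomes
affine in quantities that can be summed over nodes and averaged over draws (`meanSS_succ_le`,
`exists_meanSS_le`, `meanSS_le`).

Generalization. Splits are replaced by p(n+1) grid splits, each wrong only on a set of probability
at most 1/n, and leaf values are rounded to multiples of B/n (`exists_treeClass_approx`). The
resulting class has log-cardinality of order 2^K log(np). For a member f, the excess loss over μ has
mean ‖μ-f‖², and its square is at most 16B²(μ-f)². Its exponential moment thus costs only half of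
the mean, which yields ‖μ-f‖² ≤ 2 (empirical excess) + O(log/n) and is the source of the factor 2 in
the theorem. The bootstrap is handled by comparison with independent Poisson(1) multiplicities, for
which exponential moments factor over the data (`expect_exp_bootstrap_le`).

Finally the forest is no worse than its average tree by convexity, and averaging over the bootstrap
turns the resampled excess loss of g into its sum over the original data, with mean n‖μ-g‖². -/

theorem abs_sum_mul_sub_le (f w : ℝ → ℝ) {M : ℝ} (hM : 0 ≤ M) (T : Finset ℝ) :
    eVariationOn f T ≠ ⊤ →
    (∀ b ∈ T, ∀ c ∈ T, b < c → |∑ x ∈ T with x ≤ b, w x| ≤ M) →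
    ∀ b ∈ T, (∀ x ∈ T, x ≤ b) →
      |∑ x ∈ T, w x * f x - f b * ∑ x ∈ T, w x| ≤ M * (eVariationOn f T).toReal := by
  induction T using Finset.induction_on_max with
  | empty => simp
  | insert c T hc ih =>
    intro hfin hM' b hb hbmax
    have hcT : c ∉ T := fun h => lt_irrefl _ (hc c h)
    obtain rfl : b = c := by
      rcases Finset.mem_insert.1 hb with h | h
      · exact h
      · exact absurd (hc b h) (not_lt.2 (hbmax c (Finset.mem_insert_self _ _)))
    rw [Finset.sum_insert hcT, Finset.sum_insert hcT]
    rcases T.eq_empty_or_nonempty with rfl | hne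
    · simp only [Finset.sum_empty, add_zero]
      rw [show w b * f b - f b * w b = 0 by ring, abs_zero]
      positivity
    · set d := T.max' hne with hd
      have hdT : d ∈ T := T.max'_mem hne
      have hdmax : ∀ x ∈ T, x ≤ d := fun x hx => T.le_max' x hx
      have hle : eVariationOn f T + edist (f d) (f b) ≤
          eVariationOn f (insert b T : Finset ℝ) := by
        have h1 : eVariationOn f ({d, b} : Set ℝ) ≥ edist (f d) (f b) :=
          eVariationOn.edist_le f (by simp) (by simp)
        have h2 := eVariationOn.add_le_union f (s := (T : Set ℝ)) (t := {d, b}) (by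
          intro x hx y hy
          rcases hy with rfl | rfl
          · exact hdmax x hx
          · exact (hc x hx).le)
        refine (add_le_add le_rfl h1).trans (h2.trans (eVariationOn.mono f ?_))
        intro x hx
        rcases hx with hx | rfl | rfl
        · simpa using Or.inr hx
        · simpa using Or.inr hdT
        · simp
      have hT : eVariationOn f T ≠ ⊤ := ne_top_of_le_ne_top hfin (le_self_add.trans hle)
      have hfl : ∀ a ∈ T, ({x ∈ insert b T | x ≤ a} : Finset ℝ) = {x ∈ T | x ≤ a} := by
        intro a ha
        rw [Finset.filter_insert, if_neg (not_le.2 (hc a ha))]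
      have hi := ih hT (fun a ha e he hae => by
        have := hM' a (Finset.mem_insert_of_mem ha) e (Finset.mem_insert_of_mem he) hae
        rwa [hfl a ha] at this) d hdT hdmax
      have hW : |∑ x ∈ T, w x| ≤ M := by
        have := hM' d (Finset.mem_insert_of_mem hdT) b (Finset.mem_insert_self _ _) (hc d hdT)
        rwa [hfl d hdT, Finset.filter_true_of_mem hdmax] at this
      have hreal : (eVariationOn f T).toReal + |f d - f b| ≤
          (eVariationOn f (insert b T : Finset ℝ)).toReal := by
        have := ENNReal.toReal_mono hfin hle
        rwa [ENNReal.toReal_add hT (edist_ne_top _ _), edist_dist, ENNReal.toReal_ofReal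
          dist_nonneg, Real.dist_eq] at this
      -- Abel summation: moving the reference point from d to b cancels the new term and leaves one
      -- jump of f times the sum over T. That sum is a proper partial sum because b lies beyond T,
      -- so the bound on partial sums is never needed for the full sum.
      have e : w b * f b + ∑ x ∈ T, w x * f x - f b * (w b + ∑ x ∈ T, w x) =
          (∑ x ∈ T, w x * f x - f d * ∑ x ∈ T, w x) + (f d - f b) * ∑ x ∈ T, w x := by ring
      rw [e]
      calc _ ≤ M * (eVariationOn f T).toReal + |f d - f b| * M := by
            refine (abs_add_le _ _).trans (add_le_add hi ?_)
            rw [abs_mul]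
            exact mul_le_mul_of_nonneg_left hW (abs_nonneg _)
        _ = M * ((eVariationOn f T).toReal + |f d - f b|) := by ring
        _ ≤ _ := mul_le_mul_of_nonneg_left hreal hM

/-- Since the r i sum to zero, the boundary term of the summation by parts vanishes. Partial sums
matter only at thresholds with points on both sides, which are exactly those allowed as splits.
Indices with equal x i are merged into one weight. -/
theorem abs_sum_mul_comp_le {ι : Type*} (A : Finset ι) (x r : ι → ℝ) (f : ℝ → ℝ) {M : ℝ}
    (hM : 0 ≤ M) (s : Set ℝ) (hs : ∀ i ∈ A, x i ∈ s) (hf : eVariationOn f s ≠ ⊤)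
    (hr : ∑ i ∈ A, r i = 0)
    (h : ∀ b, (∃ i ∈ A, x i ≤ b) → (∃ i ∈ A, b < x i) → |∑ i ∈ A with x i ≤ b, r i| ≤ M) :
    |∑ i ∈ A, r i * f (x i)| ≤ M * (eVariationOn f s).toReal := by
  classical
  rcases A.eq_empty_or_nonempty with rfl | hne
  · simp only [Finset.sum_empty, abs_zero]; positivity
  set T : Finset ℝ := A.image x
  have hTne : T.Nonempty := hne.image x
  have hTs : (T : Set ℝ) ⊆ s := by
    intro y hy
    obtain ⟨i, hi, rfl⟩ := Finset.mem_image.1 (Finset.mem_coe.1 hy)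
    exact hs i hi
  set w : ℝ → ℝ := fun y => ∑ i ∈ A with x i = y, r i
  have hw : ∀ φ : ℝ → ℝ, ∑ y ∈ T, w y * φ y = ∑ i ∈ A, r i * φ (x i) := by
    intro φ
    rw [← Finset.sum_fiberwise_of_maps_to (t := T) (g := x)
      (fun i hi => Finset.mem_image_of_mem x hi)]
    refine Finset.sum_congr rfl fun y _ => ?_
    rw [Finset.sum_mul]
    refine Finset.sum_congr rfl fun i hi => ?_
    rw [(Finset.mem_filter.1 hi).2]
  have hmono := eVariationOn.mono f hTs
  have key := abs_sum_mul_sub_le f w hM T (ne_top_of_le_ne_top hf hmono) (by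
    intro b hb c hc hbc
    obtain ⟨i, hi, hib⟩ := Finset.mem_image.1 hb
    obtain ⟨k, hk, hkc⟩ := Finset.mem_image.1 hc
    have h1 := hw fun y => if y ≤ b then 1 else 0
    simp only [mul_ite, mul_one, mul_zero, ← Finset.sum_filter] at h1
    rw [h1]
    exact h b ⟨i, hi, hib.le⟩ ⟨k, hk, hkc ▸ hbc⟩) (T.max' hTne) (T.max'_mem hTne)
    (fun y hy => T.le_max' y hy)
  have h0 : ∑ y ∈ T, w y = 0 := by simpa [hr] using hw fun _ => 1
  rw [h0, mul_zero, sub_zero, hw] at key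
  exact key.trans (mul_le_mul_of_nonneg_left (ENNReal.toReal_mono hf hmono) hM)

/-! ### Impurity -/

section Node

variable {n p : ℕ} (Z : Sample n p) (t : Node p)

/-- The sum of squared deviations of the responses in a node from their mean. -/
noncomputable def nodeSS : ℝ := ∑ i ∈ members Z t, ((Z i).2 - nodeMean Z t) ^ 2

/-- The sum of squared residuals of `h` at the sample points in a node. -/
noncomputable def residualSS (h : (Fin p → ℝ) → ℝ) : ℝ :=
  ∑ i ∈ members Z t, ((Z i).2 - h (Z i).1) ^ 2

variable {Z t}

theorem mem_members {i : Fin n} : i ∈ members Z t ↔ (Z i).1 ∈ t := by simp [members]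

theorem sum_members_split (c : Split p) (φ : Fin n → ℝ) :
    ∑ i ∈ members Z (leftNode t c), φ i + ∑ i ∈ members Z (rightNode t c), φ i =
      ∑ i ∈ members Z t, φ i := by
  classical
  rw [← Finset.sum_union]
  · refine Finset.sum_congr ?_ fun _ _ => rfl
    ext i
    simp only [Finset.mem_union, mem_members, leftNode, rightNode, Set.mem_ofPred_eq]
    constructor
    · rintro (h | h) <;> exact h.1
    · intro h
      rcases le_or_gt ((Z i).1 c.1) c.2 with h' | h'
      · exact Or.inl ⟨h, h'⟩
      · exact Or.inr ⟨h, h'⟩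
  · rw [Finset.disjoint_left]
    intro i hi hi'
    exact absurd (mem_members.1 hi).2 (not_le.2 (mem_members.1 hi').2)

theorem count_split (c : Split p) :
    (count Z (leftNode t c) : ℝ) + count Z (rightNode t c) = count Z t := by
  simpa [count] using sum_members_split (Z := Z) (t := t) c fun _ => 1

theorem count_mul_nodeMean : (count Z t : ℝ) * nodeMean Z t = ∑ i ∈ members Z t, (Z i).2 := by
  rcases Nat.eq_zero_or_pos (count Z t) with h | h
  · have : members Z t = ∅ := Finset.card_eq_zero.1 h
    simp [h, this]
  · unfold nodeMean
    field_simp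

theorem sum_sub_nodeMean : ∑ i ∈ members Z t, ((Z i).2 - nodeMean Z t) = 0 := by
  rw [Finset.sum_sub_distrib, ← count_mul_nodeMean]
  simp [count]

theorem sum_sub_const_sq (a : ℝ) :
    ∑ i ∈ members Z t, ((Z i).2 - a) ^ 2 =
      nodeSS Z t + count Z t * (nodeMean Z t - a) ^ 2 := by
  have : ∀ i, ((Z i).2 - a) ^ 2 = ((Z i).2 - nodeMean Z t) ^ 2 +
      2 * (nodeMean Z t - a) * ((Z i).2 - nodeMean Z t) + (nodeMean Z t - a) ^ 2 := by
    intro i; ring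
  simp only [this, Finset.sum_add_distrib, ← Finset.mul_sum, sum_sub_nodeMean]
  simp [nodeSS, count]

theorem count_mul_impurity : (count Z t : ℝ) * impurity Z t = nodeSS Z t := by
  rcases Nat.eq_zero_or_pos (count Z t) with h | h
  · have : members Z t = ∅ := Finset.card_eq_zero.1 h
    simp [h, this, nodeSS]
  · unfold impurity nodeSS
    field_simp

theorem residualSS_nonneg (h : (Fin p → ℝ) → ℝ) : 0 ≤ residualSS Z t h :=
  Finset.sum_nonneg fun _ _ => sq_nonneg _

theorem residualSS_split (h : (Fin p → ℝ) → ℝ) (c : Split p) :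
    residualSS Z (leftNode t c) h + residualSS Z (rightNode t c) h = residualSS Z t h :=
  sum_members_split c _

theorem count_mul_gain {c : Split p} (h : 0 < count Z t) :
    (count Z t : ℝ) * gain Z t c =
      nodeSS Z t - nodeSS Z (leftNode t c) - nodeSS Z (rightNode t c) := by
  have h' : (count Z t : ℝ) ≠ 0 := by exact_mod_cast h.ne'
  rw [← count_mul_impurity, ← count_mul_impurity, ← count_mul_impurity, gain]
  field_simp
  ring

/-- With daughter sizes l, r and daughter means a, b relative to the node mean, N · gain = l a² + r
b² and l a + r b = 0. Hence N² · gain = (l + r)² l a² / r, and (l + r)² ≥ 4 l r gives the bound. -/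
theorem four_mul_sq_le_gain {c : Split p} (hL : 0 < count Z (leftNode t c))
    (hR : 0 < count Z (rightNode t c)) :
    4 * (∑ i ∈ members Z (leftNode t c), ((Z i).2 - nodeMean Z t)) ^ 2 ≤
      (count Z t : ℝ) ^ 2 * gain Z t c := by
  have hN := count_split (Z := Z) (t := t) c
  have hL' : (0 : ℝ) < count Z (leftNode t c) := by exact_mod_cast hL
  have hR' : (0 : ℝ) < count Z (rightNode t c) := by exact_mod_cast hR
  have hNpos : (0 : ℝ) < count Z t := by linarith
  have hg := count_mul_gain (Z := Z) (t := t) (c := c) (by exact_mod_cast hNpos)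
  have hs := sum_members_split (Z := Z) (t := t) c fun i => ((Z i).2 - nodeMean Z t) ^ 2
  rw [sum_sub_const_sq, sum_sub_const_sq] at hs
  change _ = nodeSS Z t at hs
  have hl := sum_members_split (Z := Z) (t := t) c fun i => ((Z i).2 - nodeMean Z t)
  rw [sum_sub_nodeMean] at hl
  have e1 : ∀ u : Node p, ∑ i ∈ members Z u, ((Z i).2 - nodeMean Z t) =
      count Z u * (nodeMean Z u - nodeMean Z t) := by
    intro u
    rw [mul_sub, count_mul_nodeMean, Finset.sum_sub_distrib]
    simp [count]
  rw [e1, e1] at hl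
  rw [e1]
  set a := nodeMean Z (leftNode t c) - nodeMean Z t
  set b := nodeMean Z (rightNode t c) - nodeMean Z t
  set l : ℝ := (count Z (leftNode t c) : ℝ)
  set r : ℝ := (count Z (rightNode t c) : ℝ)
  rw [sq (count Z t : ℝ), mul_assoc, hg, ← hs, ← hN]
  have hb : b = -(l * a) / r := by field_simp; linarith
  rw [hb]
  have : (l + r) * (nodeSS Z (leftNode t c) + l * a ^ 2 +
      (nodeSS Z (rightNode t c) + r * (-(l * a) / r) ^ 2) - nodeSS Z (leftNode t c) -
      nodeSS Z (rightNode t c)) - 4 * (l * a) ^ 2 = l * a ^ 2 * (l - r) ^ 2 / r := by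
    field_simp; ring
  have h2 : 0 ≤ l * a ^ 2 * (l - r) ^ 2 / r := by positivity
  linarith

theorem gain_nonneg {c : Split p} (hL : 0 < count Z (leftNode t c))
    (hR : 0 < count Z (rightNode t c)) : 0 ≤ gain Z t c := by
  have h := four_mul_sq_le_gain hL hR
  have hN := count_split (Z := Z) (t := t) c
  have hL' : (0 : ℝ) < count Z (leftNode t c) := by exact_mod_cast hL
  have hNpos : (0 : ℝ) < (count Z t : ℝ) ^ 2 := by
    have : (0 : ℝ) ≤ count Z (rightNode t c) := by positivity
    have : (0 : ℝ) < count Z t := by linarith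
    positivity
  by_contra! hneg
  have := mul_neg_of_pos_of_neg hNpos hneg
  nlinarith [sq_nonneg (∑ i ∈ members Z (leftNode t c), ((Z i).2 - nodeMean Z t))]

theorem nodeSS_eq_zero_of_isFinal (h : IsFinal Z t) : nodeSS Z t = 0 := by
  have hall : ∀ i ∈ members Z t, ∀ i' ∈ members Z t, (Z i).2 = (Z i').2 := by
    rcases h with h | h
    · intro i hi i' hi'
      obtain ⟨k, hk⟩ := Finset.card_eq_one.1 h
      rw [hk, Finset.mem_singleton] at hi hi'
      rw [hi, hi']
    · exact h
  refine Finset.sum_eq_zero fun i hi => ?_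
  have : nodeMean Z t = (Z i).2 := by
    have hpos : (count Z t : ℝ) ≠ 0 := by
      exact_mod_cast (Finset.card_pos.2 ⟨i, hi⟩).ne'
    have h2 := count_mul_nodeMean (Z := Z) (t := t)
    rw [Finset.sum_congr rfl fun k hk => hall k hk i hi] at h2
    simp only [Finset.sum_const, nsmul_eq_mul] at h2
    exact mul_left_cancel₀ hpos h2
  rw [this]; ring

/-- A bound for the excess training error in a node by the largest impurity gain. -/
theorem two_mul_excess_le (f : Fin p → ℝ → ℝ) (s : Fin p → Set ℝ)
    (hs : ∀ i j, (Z i).1 j ∈ s j) (hf : ∀ j, eVariationOn (f j) (s j) ≠ ⊤) {V D u : ℝ}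
    (hV : ∑ j, (eVariationOn (f j) (s j)).toReal ≤ V) (hD : 0 ≤ D)
    (hgain : ∀ c, IsCandidate Z t Finset.univ c → gain Z t c ≤ D) (hu : 0 ≤ u) :
    2 * u * (nodeSS Z t - residualSS Z t fun x => ∑ j, f j (x j)) - count Z t * u ^ 2 ≤
      count Z t * (V ^ 2 * D) := by
  set N : ℝ := (count Z t : ℝ)
  have hN : 0 ≤ N := by positivity
  set g : (Fin p → ℝ) → ℝ := fun x => ∑ j, f j (x j)
  set r : Fin n → ℝ := fun i => (Z i).2 - nodeMean Z t with hr
  set Q := Real.sqrt D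
  have hQ : 0 ≤ Q := Real.sqrt_nonneg _
  have hQ2 : Q ^ 2 = D := Real.sq_sqrt hD
  have h1 : ∀ j, |∑ i ∈ members Z t, r i * f j ((Z i).1 j)| ≤
      N * Q / 2 * (eVariationOn (f j) (s j)).toReal := by
    intro j
    refine abs_sum_mul_comp_le (members Z t) (fun i => (Z i).1 j) r (f j) (by positivity) (s j)
      (fun i _ => hs i j) (hf j) sum_sub_nodeMean ?_
    rintro b ⟨i, hi, hib⟩ ⟨k, hk, hkb⟩
    have hL : 0 < count Z (leftNode t (j, b)) :=
      Finset.card_pos.2 ⟨i, mem_members.2 ⟨mem_members.1 hi, hib⟩⟩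
    have hR : 0 < count Z (rightNode t (j, b)) :=
      Finset.card_pos.2 ⟨k, mem_members.2 ⟨mem_members.1 hk, hkb⟩⟩
    have hset : ({i ∈ members Z t | (Z i).1 j ≤ b} : Finset (Fin n)) =
        members Z (leftNode t (j, b)) := by
      ext i; simp [mem_members, leftNode]
    rw [hset]
    refine abs_le_of_sq_le_sq ?_ (by positivity)
    have h4 := four_mul_sq_le_gain hL hR
    have h5 := mul_le_mul_of_nonneg_left (hgain (j, b) ⟨Finset.mem_univ _, hL, hR⟩) (sq_nonneg N)
    calc (∑ i ∈ members Z (leftNode t (j, b)), r i) ^ 2 ≤ N ^ 2 * D / 4 := by linarith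
      _ = (N * Q / 2) ^ 2 := by rw [← hQ2]; ring
  have h2 : ∑ i ∈ members Z t, r i * g (Z i).1 ≤ N * Q / 2 * V := by
    have e : ∑ i ∈ members Z t, r i * g (Z i).1 =
        ∑ j, ∑ i ∈ members Z t, r i * f j ((Z i).1 j) := by
      rw [Finset.sum_comm]
      simp only [g, Finset.mul_sum]
    rw [e]
    calc _ ≤ ∑ j, N * Q / 2 * (eVariationOn (f j) (s j)).toReal :=
          Finset.sum_le_sum fun j _ => (le_abs_self _).trans (h1 j)
      _ = N * Q / 2 * ∑ j, (eVariationOn (f j) (s j)).toReal := by rw [Finset.mul_sum]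
      _ ≤ _ := mul_le_mul_of_nonneg_left hV (by positivity)
  -- With m the node mean, r² - (y - g)² = 2r(g - m) - (g - m)². The square is discarded, and m
  -- drops out because r sums to zero.
  have h3 : nodeSS Z t - residualSS Z t g ≤ 2 * ∑ i ∈ members Z t, r i * g (Z i).1 := by
    have h0 : ∑ i ∈ members Z t, r i = 0 := sum_sub_nodeMean
    have : nodeSS Z t - residualSS Z t g + ∑ i ∈ members Z t, (g (Z i).1 - nodeMean Z t) ^ 2 =
        2 * ∑ i ∈ members Z t, r i * g (Z i).1 - 2 * nodeMean Z t * ∑ i ∈ members Z t, r i := by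
      unfold nodeSS residualSS
      rw [Finset.mul_sum, Finset.mul_sum, ← Finset.sum_sub_distrib, ← Finset.sum_sub_distrib,
        ← Finset.sum_add_distrib]
      refine Finset.sum_congr rfl fun i _ => ?_
      simp only [hr]; ring
    rw [h0] at this
    have hnn : 0 ≤ ∑ i ∈ members Z t, (g (Z i).1 - nodeMean Z t) ^ 2 :=
      Finset.sum_nonneg fun _ _ => sq_nonneg _
    linarith
  have h4 : nodeSS Z t - residualSS Z t g ≤ N * (Q * V) := by linarith
  have h5 := mul_le_mul_of_nonneg_left h4 hu
  -- The square gives 2uQV - u² ≤ (QV)². This tangent form of the squared inequality stays valid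
  -- when the excess is negative and is linear in the excess.
  have h6 : 0 ≤ N * (u - Q * V) ^ 2 := by positivity
  rw [← hQ2]
  nlinarith

end Node

/-! ### Averages over the draws -/

theorem expect_apply_coord {ι α : Type*} [Fintype ι] [DecidableEq ι] [Fintype α] [Nonempty α]
    (i : ι) (F : α → ℝ) : 𝔼 φ : ι → α, F (φ i) = 𝔼 a, F a := by
  classical
  rw [Fintype.expect_equiv (Equiv.funSplitAt i α) (fun φ => F (φ i))
    (fun z : α × ({j // j ≠ i} → α) => F z.1) (fun φ => rfl), ← Finset.univ_product_univ,
    Finset.expect_product]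
  simp

instance instNonemptyDraws {p q : ℕ} [Nonempty (QSubset p q)] : (K : ℕ) → Nonempty (Draws p q K)
  | 0 => inferInstanceAs (Nonempty Unit)
  | K + 1 =>
    letI := instNonemptyDraws (p := p) (q := q) K
    inferInstanceAs (Nonempty (QSubset p q × (Bool → Draws p q K)))

theorem nonempty_qSubset {p q : ℕ} (h : q ≤ p) : Nonempty (QSubset p q) := by
  obtain ⟨S, -, hS⟩ := Finset.exists_subset_card_eq (s := (Finset.univ : Finset (Fin p)))
    (n := q) (by simpa using h)
  exact ⟨⟨S, hS⟩⟩

/-- The element of `Draws p q (K + 1)` with given root and subtrees. -/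
def Draws.node {p q K : ℕ} (S : QSubset p q) (φ : Bool → Draws p q K) : Draws p q (K + 1) :=
  (show QSubset p q × (Bool → Draws p q K) from (S, φ))

theorem expect_draws_succ {p q K : ℕ} (F : Draws p q (K + 1) → ℝ) :
    𝔼 ξ, F ξ = 𝔼 S : QSubset p q, 𝔼 φ : Bool → Draws p q K, F (Draws.node S φ) := by
  rw [← Finset.expect_product' Finset.univ Finset.univ fun S φ => F (Draws.node S φ)]
  rfl

/-- The sets that miss j are the q-subsets of the other variables; Pascal's rule and the absorption
identity for binomial coefficients give the proportion of the rest. -/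
theorem expect_mem_qSubset {p q : ℕ} (hq : 1 ≤ q) (hqp : q ≤ p) (j : Fin p) :
    𝔼 S : QSubset p q, (if j ∈ S.1 then (1 : ℝ) else 0) = q / p := by
  classical
  obtain ⟨p, rfl⟩ : ∃ k, p = k + 1 := ⟨p - 1, by omega⟩
  obtain ⟨q, rfl⟩ : ∃ k, q = k + 1 := ⟨q - 1, by omega⟩
  have hsub : ∀ F : Finset (Fin (p + 1)) → ℝ, ∑ S : QSubset (p + 1) (q + 1), F S.1 =
      ∑ S ∈ Finset.powersetCard (q + 1) Finset.univ, F S := fun F =>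
    (Finset.sum_subtype _ (fun S => by simp) F).symm
  have hcard : (Fintype.card (QSubset (p + 1) (q + 1)) : ℝ) = (p + 1).choose (q + 1) := by
    simp
  rw [Fintype.expect_eq_sum_div_card, hcard, hsub fun S => if j ∈ S then (1 : ℝ) else 0]
  have hnot : ∑ S ∈ Finset.powersetCard (q + 1) (Finset.univ : Finset (Fin (p + 1))),
      (if j ∉ S then (1 : ℝ) else 0) = p.choose (q + 1) := by
    rw [← Finset.sum_filter, Finset.sum_const, nsmul_eq_mul, mul_one]
    have : (Finset.powersetCard (q + 1) (Finset.univ : Finset (Fin (p + 1)))).filter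
        (fun S => j ∉ S) = Finset.powersetCard (q + 1) (Finset.univ.erase j) := by
      ext S
      simp only [Finset.mem_filter, Finset.mem_powersetCard, Finset.subset_univ, true_and,
        Finset.subset_erase]
      tauto
    rw [this, Finset.card_powersetCard]
    simp
  have hall : ∑ S ∈ Finset.powersetCard (q + 1) (Finset.univ : Finset (Fin (p + 1))),
      (if j ∈ S then (1 : ℝ) else 0) + p.choose (q + 1) = (p + 1).choose (q + 1) := by
    rw [← hnot, ← Finset.sum_add_distrib]
    have : ∀ S : Finset (Fin (p + 1)), ((if j ∈ S then (1 : ℝ) else 0) +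
        if j ∉ S then (1 : ℝ) else 0) = 1 := by
      intro S; by_cases h : j ∈ S <;> simp [h]
    simp only [this]; simp
  have hpas : ((p + 1).choose (q + 1) : ℝ) = p.choose q + p.choose (q + 1) := by
    exact_mod_cast Nat.choose_succ_succ p q
  have hmul : ((p : ℝ) + 1) * p.choose q = (p + 1).choose (q + 1) * (q + 1) := by
    exact_mod_cast Nat.add_one_mul_choose_eq p q
  have hpos : (0 : ℝ) < (p + 1).choose (q + 1) := by exact_mod_cast Nat.choose_pos hqp
  rw [div_eq_div_iff hpos.ne' (by positivity)]
  push_cast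
  nlinarith

/-! ### The training error of a tree -/

section Training

variable {n p q : ℕ} {rule : SplitRule n p} {Z : Sample n p}

theorem residualSS_congr {t : Node p} {h h' : (Fin p → ℝ) → ℝ} (hh : ∀ x ∈ t, h x = h' x) :
    residualSS Z t h = residualSS Z t h' :=
  Finset.sum_congr rfl fun i hi => by rw [hh _ (mem_members.1 hi)]

theorem IsCandidate.count_pos {t : Node p} {S : Finset (Fin p)} {c : Split p}
    (h : IsCandidate Z t S c) : 0 < count Z t := by
  have := count_split (Z := Z) (t := t) c
  have h1 : (0 : ℝ) < count Z (leftNode t c) := by exact_mod_cast h.2.1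
  have h2 : (0 : ℝ) ≤ count Z (rightNode t c) := by positivity
  have : (0 : ℝ) < count Z t := by linarith
  exact_mod_cast this

open Classical in
/-- The impurity gain of the split that is made when the variables in `S` are drawn. -/
noncomputable def splitGain (rule : SplitRule n p) (Z : Sample n p) (t : Node p)
    (S : Finset (Fin p)) : ℝ :=
  if ∃ c, IsCandidate Z t S c then gain Z t (rule Z t S) else 0

theorem splitGain_nonneg (hrule : IsCART rule) (t : Node p) (S : Finset (Fin p)) :
    0 ≤ splitGain rule Z t S := by
  unfold splitGain
  split_ifs with h
  · exact gain_nonneg (hrule Z t S h).1.2.1 (hrule Z t S h).1.2.2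
  · exact le_rfl

/-- Compare with the best split over all variables. With probability q/p its variable is drawn, and
CART then gains at least as much; otherwise the gain is still nonnegative. -/
theorem expect_splitGain_ge (hrule : IsCART rule) (hq : 1 ≤ q) (hqp : q ≤ p)
    (f : Fin p → ℝ → ℝ) (s : Fin p → Set ℝ) (hs : ∀ i j, (Z i).1 j ∈ s j)
    (hf : ∀ j, eVariationOn (f j) (s j) ≠ ⊤) {V u : ℝ} (hVpos : 0 < V)
    (hV : ∑ j, (eVariationOn (f j) (s j)).toReal ≤ V) (hu : 0 ≤ u) (t : Node p) :
    q / p / V ^ 2 * (2 * u * (nodeSS Z t - residualSS Z t fun x => ∑ j, f j (x j)) -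
        count Z t * u ^ 2) ≤
      count Z t * 𝔼 S : QSubset p q, splitGain rule Z t S.1 := by
  have hE0 : 0 ≤ 𝔼 S : QSubset p q, splitGain rule Z t S.1 :=
    Finset.expect_nonneg fun S _ => splitGain_nonneg hrule t S.1
  have hN : (0 : ℝ) ≤ count Z t := by positivity
  by_cases hc : ∃ c, IsCandidate Z t Finset.univ c
  · obtain ⟨h1, h2⟩ := hrule Z t Finset.univ hc
    set c := rule Z t Finset.univ
    have hg : 0 ≤ gain Z t c := gain_nonneg h1.2.1 h1.2.2
    have hkey := two_mul_excess_le f s hs hf hV hg h2 hu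
    have hE : q / p * gain Z t c ≤ 𝔼 S : QSubset p q, splitGain rule Z t S.1 := by
      rw [← expect_mem_qSubset hq hqp c.1, Finset.expect_mul]
      refine Finset.expect_le_expect fun S _ => ?_
      by_cases hS : c.1 ∈ S.1
      · have hcand : IsCandidate Z t S.1 c := ⟨hS, h1.2⟩
        have hex : ∃ c, IsCandidate Z t S.1 c := ⟨c, hcand⟩
        rw [if_pos hS, one_mul, splitGain, if_pos hex]
        exact (hrule Z t S.1 hex).2 c hcand
      · rw [if_neg hS, zero_mul]
        exact splitGain_nonneg hrule t S.1
    calc _ ≤ q / p / V ^ 2 * (count Z t * (V ^ 2 * gain Z t c)) :=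
          mul_le_mul_of_nonneg_left hkey (by positivity)
      _ = count Z t * (q / p * gain Z t c) := by field_simp
      _ ≤ _ := mul_le_mul_of_nonneg_left hE hN
  -- Without candidates the gain bound holds vacuously with D = 0, so the left-hand side is
  -- nonpositive.
  · have hkey := two_mul_excess_le (Z := Z) (t := t) f s hs hf hV le_rfl
      (fun c h => absurd ⟨c, h⟩ hc) hu
    rw [mul_zero, mul_zero] at hkey
    exact (mul_nonpos_of_nonneg_of_nonpos (by positivity) hkey).trans (mul_nonneg hN hE0)

/-- The average of the training error over the draws in the first `K` levels below `t`. -/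
noncomputable def meanSS (q : ℕ) (rule : SplitRule n p) (Z : Sample n p) (K : ℕ) (t : Node p) : ℝ :=
  𝔼 ξ : Draws p q K, residualSS Z t (grow rule Z K ξ t)

theorem meanSS_zero (t : Node p) : meanSS q rule Z 0 t = nodeSS Z t := by
  have : ∀ ξ : Draws p q 0, residualSS Z t (grow rule Z 0 ξ t) = nodeSS Z t := fun ξ => rfl
  unfold meanSS
  simp only [this]
  have : Nonempty (Draws p q 0) := inferInstanceAs (Nonempty Unit)
  exact Fintype.expect_const _

theorem meanSS_succ_of_isFinal {K : ℕ} {t : Node p} (h : IsFinal Z t) :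
    meanSS q rule Z (K + 1) t = 0 := by
  have hξ : ∀ ξ : Draws p q (K + 1), residualSS Z t (grow rule Z (K + 1) ξ t) = 0 := by
    intro ξ
    rw [← nodeSS_eq_zero_of_isFinal h]
    refine Finset.sum_congr rfl fun i _ => ?_
    rw [grow, if_pos h]
  unfold meanSS
  simp only [hξ]
  simp

-- Conditioning on the root draw. The two subtree draws enter only through their marginals, since
-- the training error is a sum over the daughters; an undivided node continues with the draws of the
-- left subtree alone.
open Classical in
theorem meanSS_succ (hqp : q ≤ p) {K : ℕ} {t : Node p} (h : ¬ IsFinal Z t) :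
    meanSS q rule Z (K + 1) t = 𝔼 S : QSubset p q,
      if ∃ c, IsCandidate Z t S.1 c then
        meanSS q rule Z K (leftNode t (rule Z t S.1)) +
          meanSS q rule Z K (rightNode t (rule Z t S.1))
      else meanSS q rule Z K t := by
  have := nonempty_qSubset hqp
  unfold meanSS
  rw [expect_draws_succ]
  refine Finset.expect_congr rfl fun S _ => ?_
  split_ifs with hc
  · have : ∀ φ : Bool → Draws p q K,
        residualSS Z t (grow rule Z (K + 1) (Draws.node S φ) t) =
        residualSS Z (leftNode t (rule Z t S.1))
            (grow rule Z K (φ false) (leftNode t (rule Z t S.1))) +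
          residualSS Z (rightNode t (rule Z t S.1))
            (grow rule Z K (φ true) (rightNode t (rule Z t S.1))) := by
      intro φ
      rw [← residualSS_split _ (rule Z t S.1)]
      congr 1
      · refine residualSS_congr fun x hx => ?_
        rw [grow, if_neg h]
        exact (if_pos hc).trans (if_pos hx.2)
      · refine residualSS_congr fun x hx => ?_
        rw [grow, if_neg h]
        exact (if_pos hc).trans (if_neg (not_le.2 hx.2))
    simp only [this]
    rw [Finset.expect_add_distrib,
      expect_apply_coord false fun ξ : Draws p q K => residualSS Z (leftNode t (rule Z t S.1))
        (grow rule Z K ξ (leftNode t (rule Z t S.1))),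
      expect_apply_coord true fun ξ : Draws p q K => residualSS Z (rightNode t (rule Z t S.1))
        (grow rule Z K ξ (rightNode t (rule Z t S.1)))]
  · have : ∀ φ : Bool → Draws p q K,
        residualSS Z t (grow rule Z (K + 1) (Draws.node S φ) t) =
        residualSS Z t (grow rule Z K (φ false) t) := by
      intro φ
      refine residualSS_congr fun x _ => ?_
      rw [grow, if_neg h]
      exact if_neg hc
    simp only [this]
    rw [expect_apply_coord false fun ξ : Draws p q K => residualSS Z t (grow rule Z K ξ t)]

/-- The hypothesis is applied to both daughters. Residuals of the additive function and counts are
additive over daughters, while `nodeSS` drops by N · gain, whose mean is bounded below by an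
expression linear in `nodeSS`. In terms of excess per point, the new affine bound is the old one
composed with x ↦ x - γ(2ux - u²). The bound 2γu ≤ 1 keeps the coefficient of `nodeSS` nonnegative.
-/
theorem meanSS_succ_le (hrule : IsCART rule) (hq : 1 ≤ q) (hqp : q ≤ p)
    (f : Fin p → ℝ → ℝ) (s : Fin p → Set ℝ) (hs : ∀ i j, (Z i).1 j ∈ s j)
    (hf : ∀ j, eVariationOn (f j) (s j) ≠ ⊤) {V u : ℝ} (hVpos : 0 < V)
    (hV : ∑ j, (eVariationOn (f j) (s j)).toReal ≤ V) (hu : 0 ≤ u)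
    (hu1 : 2 * (q / p / V ^ 2) * u ≤ 1) {K : ℕ} {σ β : ℝ} (hσ : 0 ≤ σ) (hσ1 : σ ≤ 1)
    (hβ : 0 ≤ β) (h : ∀ t, meanSS q rule Z K t ≤ σ * nodeSS Z t +
      (1 - σ) * residualSS Z t (fun x => ∑ j, f j (x j)) + β * count Z t) (t : Node p) :
    meanSS q rule Z (K + 1) t ≤ σ * (1 - 2 * (q / p / V ^ 2) * u) * nodeSS Z t +
      (1 - σ * (1 - 2 * (q / p / V ^ 2) * u)) * residualSS Z t (fun x => ∑ j, f j (x j)) +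
      (β + σ * (q / p / V ^ 2) * u ^ 2) * count Z t := by
  classical
  have := nonempty_qSubset hqp
  set γ : ℝ := q / p / V ^ 2
  have hγ : 0 ≤ γ := by positivity
  set g : (Fin p → ℝ) → ℝ := fun x => ∑ j, f j (x j)
  have hG := residualSS_nonneg (Z := Z) (t := t) g
  by_cases hfin : IsFinal Z t
  · rw [meanSS_succ_of_isFinal hfin, nodeSS_eq_zero_of_isFinal hfin, mul_zero, zero_add]
    have hle : σ * (1 - 2 * γ * u) ≤ 1 := by
      have h0 : 0 ≤ 2 * γ * u := by positivity
      have h1 : σ * (1 - 2 * γ * u) ≤ 1 * 1 :=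
        mul_le_mul hσ1 (by linarith) (by linarith) zero_le_one
      linarith
    exact add_nonneg (mul_nonneg (by linarith) hG) (by positivity)
  · rw [meanSS_succ hqp hfin]
    have hb : ∀ S : QSubset p q,
        (if ∃ c, IsCandidate Z t S.1 c then
          meanSS q rule Z K (leftNode t (rule Z t S.1)) +
            meanSS q rule Z K (rightNode t (rule Z t S.1))
        else meanSS q rule Z K t) ≤ σ * nodeSS Z t + (1 - σ) * residualSS Z t g +
          β * count Z t - σ * count Z t * splitGain rule Z t S.1 := by
      intro S
      unfold splitGain
      split_ifs with hc
      · have hcand := (hrule Z t S.1 hc).1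
        set c := rule Z t S.1
        have e1 := count_mul_gain (c := c) hcand.count_pos
        have e2 := residualSS_split (Z := Z) (t := t) g c
        have e3 := count_split (Z := Z) (t := t) c
        have hL := h (leftNode t c)
        have hR := h (rightNode t c)
        rw [mul_assoc σ, e1, ← e2, ← e3]
        linarith
      · simpa using h t
    refine (Finset.expect_le_expect fun S _ => hb S).trans ?_
    rw [Finset.expect_sub_distrib, Fintype.expect_const, ← Finset.mul_expect]
    have hE := expect_splitGain_ge hrule hq hqp f s hs hf hVpos hV hu t
    have := mul_le_mul_of_nonneg_left hE hσ
    change σ * (γ * (2 * u * (nodeSS Z t - residualSS Z t g) - count Z t * u ^ 2)) ≤ _ at this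
    linarith

/-- The quantity β + σ/(γm), with γ = q/(pV²), is the bound produced by an initial excess of 1/(γm)
per point. The affine map is composed from the root downwards: the top level takes m to m + 1, and
the induction hypothesis for m + 1 covers the remaining levels. The coefficients do not depend on
the node. -/
theorem exists_meanSS_le (hrule : IsCART rule) (hq : 1 ≤ q) (hqp : q ≤ p)
    (f : Fin p → ℝ → ℝ) (s : Fin p → Set ℝ) (hs : ∀ i j, (Z i).1 j ∈ s j)
    (hf : ∀ j, eVariationOn (f j) (s j) ≠ ⊤) {V : ℝ} (hVpos : 0 < V)
    (hV : ∑ j, (eVariationOn (f j) (s j)).toReal ≤ V) (K : ℕ) : ∀ m : ℝ, 2 ≤ m →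
    ∃ σ β : ℝ, 0 ≤ σ ∧ σ ≤ 1 ∧ 0 ≤ β ∧
      β + σ / (q / p / V ^ 2 * m) ≤ 1 / (q / p / V ^ 2 * (m + K)) ∧
      ∀ t, meanSS q rule Z K t ≤ σ * nodeSS Z t +
        (1 - σ) * residualSS Z t (fun x => ∑ j, f j (x j)) + β * count Z t := by
  have hp0 : (0 : ℝ) < p := by exact_mod_cast (by omega : 0 < p)
  have hq0 : (0 : ℝ) < q := by exact_mod_cast hq
  induction K with
  | zero =>
    intro m hm
    refine ⟨1, 0, zero_le_one, le_rfl, le_rfl, by simp, fun t => ?_⟩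
    rw [meanSS_zero]
    simp
  | succ K ih =>
    intro m hm
    have hm0 : 0 < m := by linarith
    obtain ⟨σ, β, h0, h1, h2, h3, h4⟩ := ih (m + 1) (by linarith)
    set γ : ℝ := q / p / V ^ 2 with hγdef
    have hγ : 0 < γ := by positivity
    have e : 2 * γ * (1 / (γ * m)) = 2 / m := by field_simp
    have hu1 : 2 * γ * (1 / (γ * m)) ≤ 1 := by
      rw [e, div_le_one hm0]; exact hm
    have h5 := meanSS_succ_le hrule hq hqp f s hs hf hVpos hV
      (u := 1 / (γ * m)) (by positivity) hu1 h0 h1 h2 h4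
    refine ⟨_, _, ?_, ?_, ?_, ?_, h5⟩
    · exact mul_nonneg h0 (by linarith)
    · have h6 : 0 ≤ 2 * γ * (1 / (γ * m)) := by positivity
      calc _ ≤ 1 * 1 := mul_le_mul h1 (by linarith) (by linarith) zero_le_one
        _ = 1 := one_mul 1
    · positivity
    · change β + σ * γ * (1 / (γ * m)) ^ 2 + σ * (1 - 2 * γ * (1 / (γ * m))) / (γ * m) ≤ _
      rw [e]
      -- With u = 1/(γm), the value 1/(γm) is sent to (m - 1)/(γm²), which falls short of 1/(γ(m +
      -- 1)) by 1/(γm²(m + 1)).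
      have h6 : β + σ * γ * (1 / (γ * m)) ^ 2 + σ * (1 - 2 / m) / (γ * m) =
          β + σ / (γ * (m + 1)) - σ / (γ * m ^ 2 * (m + 1)) := by
        field_simp; ring
      have h7 : 0 ≤ σ / (γ * m ^ 2 * (m + 1)) := by positivity
      rw [h6]
      push_cast
      rw [show m + (K + 1 : ℝ) = m + 1 + K by ring]
      linarith

/-- The average training error of a tree of depth `K`, compared with an additive function. -/
theorem meanSS_le (hrule : IsCART rule) (hq : 1 ≤ q) (hqp : q ≤ p)
    (f : Fin p → ℝ → ℝ) (s : Fin p → Set ℝ) (hs : ∀ i j, (Z i).1 j ∈ s j)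
    (hf : ∀ j, eVariationOn (f j) (s j) ≠ ⊤) {V : ℝ} (hVpos : 0 < V)
    (hV : ∑ j, (eVariationOn (f j) (s j)).toReal ≤ V) {K : ℕ} (hK : 1 ≤ K) (t : Node p) :
    meanSS q rule Z K t ≤ residualSS Z t (fun x => ∑ j, f j (x j)) +
      count Z t * (p / q * (V ^ 2 / (K + 3))) := by
  have hp0 : (0 : ℝ) < p := by exact_mod_cast (by omega : 0 < p)
  have hq0 : (0 : ℝ) < q := by exact_mod_cast hq
  obtain ⟨K, rfl⟩ : ∃ k, K = k + 1 := ⟨K - 1, by omega⟩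
  -- The top level uses u = 1/(2γ), for which 2γu = 1: the coefficient of `nodeSS` becomes 0, and
  -- the excess is at most 1/(4γ) whatever its initial value. The other levels therefore start at m
  -- = 4, which produces K + 3.
  obtain ⟨σ, β, h0, h1, h2, h3, h4⟩ :=
    exists_meanSS_le hrule hq hqp f s hs hf hVpos hV K 4 (by norm_num)
  set γ : ℝ := q / p / V ^ 2 with hγdef
  have hγ : 0 < γ := by positivity
  have e : 2 * γ * (1 / (2 * γ)) = 1 := by field_simp
  have h5 := meanSS_succ_le hrule hq hqp f s hs hf hVpos hV
      (u := 1 / (2 * γ)) (by positivity) e.le h0 h1 h2 h4 t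
  change _ ≤ σ * (1 - 2 * γ * (1 / (2 * γ))) * nodeSS Z t +
    (1 - σ * (1 - 2 * γ * (1 / (2 * γ)))) * _ + (β + σ * γ * (1 / (2 * γ)) ^ 2) * _ at h5
  rw [e] at h5
  have h6 : β + σ * γ * (1 / (2 * γ)) ^ 2 ≤ p / q * (V ^ 2 / (((K + 1 : ℕ) : ℝ) + 3)) := by
    calc _ = β + σ / (γ * 4) := by field_simp; ring
      _ ≤ 1 / (γ * (4 + K)) := h3
      _ = _ := by rw [hγdef]; push_cast; field_simp; ring
  have h7 := mul_le_mul_of_nonneg_right h6 (by positivity : (0 : ℝ) ≤ count Z t)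
  linarith

end Training

/-! ### Discretization of the splits -/

/-- Thresholds are grouped by κ(s) = ⌊n F(s)⌋, with F the distribution function, and each is
replaced by a representative of its group. Two thresholds of a group disagree only on points between
them, and there is probability less than 1/n between them. This allows atoms, which no threshold of
the group separates from itself. -/
theorem exists_quantile_grid (ν : Measure ℝ) [IsProbabilityMeasure ν] {n : ℕ} (hn : 0 < n) :
    ∃ (r : Fin (n + 1) → ℝ) (E : Fin (n + 1) → Set ℝ),
      (∀ k, MeasurableSet (E k) ∧ ν.real (E k) ≤ 1 / n) ∧
      ∀ s, ∃ k, ∀ x ∉ E k, (x ≤ s ↔ x ≤ r k) := by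
  classical
  have hn0 : (0 : ℝ) < n := by exact_mod_cast hn
  set κ : ℝ → ℕ := fun s => ⌊n * ν.real (Set.Iic s)⌋₊ with hκ
  have hκn : ∀ s, κ s < n + 1 := by
    intro s
    rw [Nat.lt_succ_iff]
    refine Nat.floor_le_of_le ?_
    have := mul_le_mul_of_nonneg_left (measureReal_le_one (μ := ν) (s := Set.Iic s)) hn0.le
    linarith
  -- The value 0 serves only indices not attained by κ, which are never selected below.
  refine ⟨fun k => if h : ∃ s, κ s = k then h.choose else 0,
    fun k => {x | ∃ s' s, κ s' = k ∧ κ s = k ∧ s' < x ∧ x ≤ s}, fun k => ?_, fun s => ?_⟩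
  · have hm : MeasurableSet {x | ∃ s' s, κ s' = k ∧ κ s = k ∧ s' < x ∧ x ≤ s} := by
      refine Set.OrdConnected.measurableSet ⟨?_⟩
      rintro x ⟨s', -, h1, -, h2, -⟩ y ⟨-, s, -, h3, -, h4⟩ z hz
      exact ⟨s', s, h1, h3, h2.trans_le hz.1, hz.2.trans h4⟩
    refine ⟨hm, ?_⟩
    by_contra! hlt
    have hlt' : ENNReal.ofReal (1 / n) < ν {x | ∃ s' s, κ s' = k ∧ κ s = k ∧ s' < x ∧ x ≤ s} := by
      rw [ENNReal.ofReal_lt_iff_lt_toReal (by positivity) (measure_ne_top _ _)]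
      exact hlt
    -- The exceptional set need not be a single difference of half-lines from its own group. By
    -- inner regularity a compact part suffices, and its extreme points place it inside one such
    -- difference.
    obtain ⟨C, hCsub, hC, hCν⟩ := hm.exists_lt_isCompact hlt'
    have hCne : C.Nonempty := by
      rw [Set.nonempty_iff_ne_empty]
      rintro rfl
      simp at hCν
    obtain ⟨a, haC, ha⟩ := hC.exists_isLeast hCne
    obtain ⟨b, hbC, hb⟩ := hC.exists_isGreatest hCne
    obtain ⟨s', -, h1, -, h2, -⟩ := hCsub haC
    obtain ⟨-, s, -, h3, -, h4⟩ := hCsub hbC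
    have hss : s' ≤ s := (h2.le.trans (ha hbC)).trans h4
    have hsub : C ⊆ Set.Iic s \ Set.Iic s' := fun x hx =>
      ⟨(hb hx).trans h4, not_le.2 (h2.trans_le (ha hx))⟩
    have hle : ν.real C ≤ ν.real (Set.Iic s) - ν.real (Set.Iic s') := by
      rw [← measureReal_sdiff (Set.Iic_subset_Iic.2 hss) measurableSet_Iic]
      exact measureReal_mono hsub
    have hCν' : 1 / (n : ℝ) < ν.real C :=
      (ENNReal.ofReal_lt_iff_lt_toReal (by positivity) (measure_ne_top _ _)).1 hCν
    have e1 : (k : ℝ) ≤ n * ν.real (Set.Iic s') := by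
      have := Nat.floor_le (a := n * ν.real (Set.Iic s')) (by positivity)
      rwa [show ⌊n * ν.real (Set.Iic s')⌋₊ = (k : ℕ) from h1] at this
    have e2 : n * ν.real (Set.Iic s) < (k : ℝ) + 1 := by
      have := Nat.lt_floor_add_one (n * ν.real (Set.Iic s))
      rwa [show ⌊n * ν.real (Set.Iic s)⌋₊ = (k : ℕ) from h3] at this
    have e3 : 1 < n * (ν.real (Set.Iic s) - ν.real (Set.Iic s')) := by
      have := mul_lt_mul_of_pos_left (hCν'.trans_le hle) hn0
      rwa [mul_one_div_cancel hn0.ne'] at this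
    linarith
  · refine ⟨⟨κ s, hκn s⟩, fun x hx => ?_⟩
    have hex : ∃ s', κ s' = κ s := ⟨s, rfl⟩
    have hr : κ hex.choose = κ s := hex.choose_spec
    simp only [dif_pos hex]
    constructor
    · intro h
      by_contra! hlt
      exact hx ⟨hex.choose, s, hr, rfl, hlt, h⟩
    · intro h
      by_contra! hlt
      exact hx ⟨s, hex.choose, rfl, hr, hlt, h⟩

theorem exists_split_grid {n p : ℕ} (P : Measure (Fin p → ℝ)) [IsProbabilityMeasure P]
    (hn : 0 < n) :
    ∃ H E : Fin p × Fin (n + 1) → Set (Fin p → ℝ),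
      (∀ i, MeasurableSet (H i)) ∧ (∀ i, MeasurableSet (E i)) ∧ (∀ i, P.real (E i) ≤ 1 / n) ∧
      ∀ c : Split p, ∃ i, ∀ x ∉ E i, (x c.1 ≤ c.2 ↔ x ∈ H i) := by
  have hm : ∀ j : Fin p, Measurable fun x : Fin p → ℝ => x j := fun j => measurable_pi_apply j
  have hprob : ∀ j : Fin p, IsProbabilityMeasure (P.map fun x => x j) := fun j =>
    Measure.isProbabilityMeasure_map (hm j).aemeasurable
  choose r E hE hr using fun j : Fin p => exists_quantile_grid (P.map fun x => x j) hn
  refine ⟨fun i => {x | x i.1 ≤ r i.1 i.2}, fun i => (fun x => x i.1) ⁻¹' E i.1 i.2,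
    fun i => measurableSet_le (hm i.1) measurable_const, fun i => hm i.1 (hE i.1 i.2).1,
    fun i => ?_, ?_⟩
  · rw [← map_measureReal_apply (hm i.1) (hE i.1 i.2).1]
    exact (hE i.1 i.2).2
  · rintro ⟨j, s⟩
    obtain ⟨k, hk⟩ := hr j s
    exact ⟨(j, k), fun x hx => hk (x j) hx⟩

/-- Equally spaced points of `[-B, B]`. -/
noncomputable def leafGrid (B : ℝ) (n : ℕ) : Finset ℝ :=
  (Finset.Icc (-(n : ℤ)) n).image fun k : ℤ => B * k / n

theorem card_leafGrid_le (B : ℝ) (n : ℕ) : (leafGrid B n).card ≤ 2 * n + 1 := by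
  refine Finset.card_image_le.trans ?_
  simp only [Int.card_Icc]
  omega

theorem abs_le_of_mem_leafGrid {B : ℝ} (hB : 0 < B) {n : ℕ} (hn : 0 < n) {w : ℝ}
    (hw : w ∈ leafGrid B n) : |w| ≤ B := by
  obtain ⟨k, hk, rfl⟩ := Finset.mem_image.1 hw
  have hn0 : (0 : ℝ) < n := by exact_mod_cast hn
  rw [Finset.mem_Icc] at hk
  have h1 : (-(n : ℝ)) ≤ k := by exact_mod_cast hk.1
  have h2 : (k : ℝ) ≤ n := by exact_mod_cast hk.2
  have h3 : |(k : ℝ)| ≤ n := abs_le.2 ⟨h1, h2⟩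
  rw [abs_div, abs_mul, abs_of_pos hB, abs_of_pos hn0, div_le_iff₀ hn0]
  exact mul_le_mul_of_nonneg_left h3 hB.le

theorem exists_mem_leafGrid {B : ℝ} (hB : 0 < B) {n : ℕ} (hn : 0 < n) {v : ℝ} (hv : |v| ≤ B) :
    ∃ w ∈ leafGrid B n, |v - w| ≤ B / n := by
  have hn0 : (0 : ℝ) < n := by exact_mod_cast hn
  obtain ⟨h1, h2⟩ := abs_le.1 hv
  have e : B * (v * n / B) / n = v := by field_simp
  refine ⟨B * ⌊v * n / B⌋ / n, Finset.mem_image.2 ⟨⌊v * n / B⌋, Finset.mem_Icc.2 ⟨?_, ?_⟩, rfl⟩, ?_⟩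
  · rw [Int.le_floor, le_div_iff₀ hB]
    push_cast
    nlinarith
  · have : (⌊v * n / B⌋ : ℝ) ≤ n := (Int.floor_le _).trans (by
      rw [div_le_iff₀ hB]; nlinarith)
    exact_mod_cast this
  · nth_rw 1 [← e]
    rw [← sub_div, ← mul_sub, abs_div, abs_mul, abs_of_pos hB, abs_of_pos hn0]
    refine div_le_div_of_nonneg_right ?_ hn0.le
    have h3 := Int.floor_le (v * n / B)
    have h4 := Int.lt_floor_add_one (v * n / B)
    have : |v * n / B - ⌊v * n / B⌋| ≤ 1 := abs_le.2 ⟨by linarith, by linarith⟩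
    calc _ ≤ B * 1 := mul_le_mul_of_nonneg_left this hB.le
      _ = B := mul_one B

/-! ### Finite classes of trees with gridded splits and leaf values -/

section TreeClass

variable {ι X : Type*} [Fintype ι]

open Classical in
/-- The functions that are piecewise constant on the cells of a binary tree with `K` levels, whose
splits are of the form `x ∈ H i` and whose values are in `L`. -/
noncomputable def treeClass (H : ι → Set X) (L : Finset ℝ) : ℕ → Finset (X → ℝ)
  | 0 => L.image fun w _ => w
  | K + 1 => (Finset.univ ×ˢ (treeClass H L K ×ˢ treeClass H L K)).image fun a x =>
      if x ∈ H a.1 then a.2.1 x else a.2.2 x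

variable {H : ι → Set X} {L : Finset ℝ} {K : ℕ}

open Classical in
theorem ite_mem_treeClass (i : ι) {f g : X → ℝ} (hf : f ∈ treeClass H L K)
    (hg : g ∈ treeClass H L K) :
    (fun x => if x ∈ H i then f x else g x) ∈ treeClass H L (K + 1) :=
  Finset.mem_image.2 ⟨(i, f, g), by simp [hf, hg], rfl⟩

theorem treeClass_mono [Nonempty ι] {f : X → ℝ} (hf : f ∈ treeClass H L K) :
    f ∈ treeClass H L (K + 1) := by
  simpa using ite_mem_treeClass (Classical.arbitrary ι) hf hf

theorem const_mem_treeClass [Nonempty ι] {w : ℝ} (hw : w ∈ L) (K : ℕ) :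
    (fun _ => w) ∈ treeClass H L K := by
  classical
  induction K with
  | zero => exact Finset.mem_image.2 ⟨w, hw, rfl⟩
  | succ K ih => exact treeClass_mono ih

theorem treeClass_induction {Q : (X → ℝ) → Prop} (h0 : ∀ w ∈ L, Q fun _ => w)
    (h1 : ∀ (i : ι) (f g : X → ℝ), Q f → Q g →
      Q fun x => open Classical in if x ∈ H i then f x else g x) :
    ∀ f ∈ treeClass H L K, Q f := by
  classical
  induction K with
  | zero =>
    intro f hf
    obtain ⟨w, hw, rfl⟩ := Finset.mem_image.1 hf
    exact h0 w hw
  | succ K ih =>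
    intro f hf
    obtain ⟨⟨i, f1, f2⟩, ha, rfl⟩ := Finset.mem_image.1 hf
    simp only [Finset.mem_product] at ha
    exact h1 i f1 f2 (ih f1 ha.2.1) (ih f2 ha.2.2)

theorem abs_le_of_mem_treeClass {B : ℝ} (hL : ∀ w ∈ L, |w| ≤ B) :
    ∀ f ∈ treeClass H L K, ∀ x, |f x| ≤ B :=
  treeClass_induction (fun w hw _ => hL w hw) fun i f g hf hg x => by
    dsimp only
    split_ifs
    · exact hf x
    · exact hg x

theorem measurable_of_mem_treeClass [MeasurableSpace X] (hH : ∀ i, MeasurableSet (H i)) :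
    ∀ f ∈ treeClass H L K, Measurable f :=
  treeClass_induction (fun _ _ => measurable_const) fun i _ _ hf hg => hf.ite (hH i) hg

/-- The extra factor |ι| turns the recursion a ↦ |ι| a² into pure squaring. -/
theorem card_treeClass_le (H : ι → Set X) (L : Finset ℝ) (K : ℕ) :
    (treeClass H L K).card * Fintype.card ι ≤ (Fintype.card ι * L.card) ^ 2 ^ K := by
  classical
  induction K with
  | zero =>
    rw [pow_zero, pow_one, mul_comm]
    exact Nat.mul_le_mul_left _ Finset.card_image_le
  | succ K ih =>
    calc (treeClass H L (K + 1)).card * Fintype.card ι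
        ≤ (Fintype.card ι * ((treeClass H L K).card * (treeClass H L K).card)) *
            Fintype.card ι := by
          refine Nat.mul_le_mul_right _ (Finset.card_image_le.trans ?_)
          simp [Finset.card_product]
      _ = ((treeClass H L K).card * Fintype.card ι) ^ 2 := by ring
      _ ≤ ((Fintype.card ι * L.card) ^ 2 ^ K) ^ 2 := Nat.pow_le_pow_left ih 2
      _ = _ := by rw [← pow_mul, pow_succ 2 K]

end TreeClass

/-! ### Approximation of grown trees by the finite class -/

theorem abs_nodeMean_le {n p : ℕ} {Z : Sample n p} {B : ℝ} (hB : 0 ≤ B)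
    (hZ : ∀ i, |(Z i).2| ≤ B) (t : Node p) : |nodeMean Z t| ≤ B := by
  rw [nodeMean, abs_div, Nat.abs_cast]
  refine div_le_of_le_mul₀ (Nat.cast_nonneg _) hB ((Finset.abs_sum_le_sum_abs _ _).trans ?_)
  refine (Finset.sum_le_card_nsmul _ _ B fun i _ => hZ i).trans ?_
  rw [nsmul_eq_mul, mul_comm]
  rfl

theorem abs_grow_le {n p q : ℕ} (rule : SplitRule n p) {Z : Sample n p} {B : ℝ} (hB : 0 ≤ B)
    (hZ : ∀ i, |(Z i).2| ≤ B) (K : ℕ) : ∀ (ξ : Draws p q K) (t : Node p) (x : Fin p → ℝ),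
    |grow rule Z K ξ t x| ≤ B := by
  induction K with
  | zero => exact fun _ t _ => abs_nodeMean_le hB hZ t
  | succ K ih =>
    intro ξ t x
    rw [grow]
    split_ifs
    · exact abs_nodeMean_le hB hZ t
    · exact ih _ _ _
    · exact ih _ _ _
    · exact ih _ _ _

/-- Off the exceptional sets of its splits, the tree follows the same branches as its gridded copy
and differs only by the rounding of the leaf. The list l collects one exceptional set per split;
there are at most 2^K - 1 splits. -/
theorem exists_treeClass_approx {n p q : ℕ} (rule : SplitRule n p) {Z : Sample n p} {B δ : ℝ}
    (hB : 0 ≤ B) (hδ : 0 ≤ δ) (hZ : ∀ i, |(Z i).2| ≤ B) {ι : Type*} [Fintype ι] [Nonempty ι]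
    {H E : ι → Set (Fin p → ℝ)} {L : Finset ℝ} (hL : ∀ w ∈ L, |w| ≤ B)
    (hLδ : ∀ v, |v| ≤ B → ∃ w ∈ L, |v - w| ≤ δ)
    (hE : ∀ c : Split p, ∃ i, ∀ x ∉ E i, (x c.1 ≤ c.2 ↔ x ∈ H i)) (K : ℕ) :
    ∀ (ξ : Draws p q K) (t : Node p), ∃ f ∈ treeClass H L K, ∃ l : List ι,
      l.length + 1 ≤ 2 ^ K ∧ ∀ x, |grow rule Z K ξ t x - f x| ≤
        δ + 2 * B * (l.map fun i => (E i).indicator (fun _ => (1 : ℝ)) x).sum := by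
  classical
  have hconst : ∀ (K : ℕ) (t : Node p), ∃ f ∈ treeClass H L K, ∃ l : List ι,
      l.length + 1 ≤ 2 ^ K ∧ ∀ x, |nodeMean Z t - f x| ≤
        δ + 2 * B * (l.map fun i => (E i).indicator (fun _ => (1 : ℝ)) x).sum := by
    intro K t
    obtain ⟨w, hw, hw'⟩ := hLδ _ (abs_nodeMean_le hB hZ t)
    exact ⟨fun _ => w, const_mem_treeClass hw K, [], by simpa using Nat.one_le_two_pow,
      fun x => by simpa using hw'⟩
  have hnn : ∀ (l : List ι) (x : Fin p → ℝ),
      0 ≤ (l.map fun i => (E i).indicator (fun _ => (1 : ℝ)) x).sum := by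
    intro l x
    refine List.sum_nonneg fun y hy => ?_
    obtain ⟨i, -, rfl⟩ := List.mem_map.1 hy
    exact Set.indicator_nonneg (fun _ _ => zero_le_one) x
  induction K with
  | zero => exact fun _ t => hconst 0 t
  | succ K ih =>
    intro ξ t
    by_cases hfin : IsFinal Z t
    · obtain ⟨f, hf, l, hl, h⟩ := hconst (K + 1) t
      refine ⟨f, hf, l, hl, fun x => ?_⟩
      rw [grow, if_pos hfin]
      exact h x
    by_cases hc : ∃ c, IsCandidate Z t ξ.root c
    · set c := rule Z t ξ.root
      obtain ⟨f1, hf1, l1, hl1, h1⟩ := ih (ξ.sub false) (leftNode t c)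
      obtain ⟨f2, hf2, l2, hl2, h2⟩ := ih (ξ.sub true) (rightNode t c)
      obtain ⟨i, hi⟩ := hE c
      refine ⟨_, ite_mem_treeClass i hf1 hf2, i :: (l1 ++ l2), ?_, fun x => ?_⟩
      · simp only [List.length_cons, List.length_append, pow_succ]
        omega
      · rw [List.map_cons, List.map_append, List.sum_cons, List.sum_append]
        have n1 := hnn l1 x
        have n2 := hnn l2 x
        -- On the exceptional set the two branches may differ, and both functions are merely bounded
        -- by B, at cost 2B.
        by_cases hx : x ∈ E i
        · rw [Set.indicator_of_mem hx]
          have b1 : |grow rule Z (K + 1) ξ t x| ≤ B := abs_grow_le rule hB hZ (K + 1) ξ t x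
          have b2 := abs_le_of_mem_treeClass hL _ (ite_mem_treeClass i hf1 hf2) x
          refine (abs_sub _ _).trans ?_
          have : 0 ≤ B * ((l1.map fun i => (E i).indicator (fun _ => (1 : ℝ)) x).sum +
            (l2.map fun i => (E i).indicator (fun _ => (1 : ℝ)) x).sum) := by positivity
          linarith
        · rw [Set.indicator_of_notMem hx, zero_add, grow, if_neg hfin, if_pos hc]
          have m1 := mul_nonneg hB n1
          have m2 := mul_nonneg hB n2
          by_cases hs : x c.1 ≤ c.2
          · rw [if_pos hs, if_pos ((hi x hx).1 hs)]
            have := h1 x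
            linarith
          · rw [if_neg hs, if_neg fun h => hs ((hi x hx).2 h)]
            have := h2 x
            linarith
    · obtain ⟨f, hf, l, hl, h⟩ := ih (ξ.sub false) t
      refine ⟨f, treeClass_mono hf, l, hl.trans (Nat.pow_le_pow_right two_pos K.le_succ),
        fun x => ?_⟩
      rw [grow, if_neg hfin, if_neg hc]
      exact h x

/-! ### Exponential moments of bootstrap sums -/

/-- Given D, the left side is the n-th power of the average x of the exp(a (D i)), and x ≤ exp(x -
1). Each factor on the right is the exponential moment of a (D i) with a Poisson(1) multiplicity, so
the resampling dependence is gone. -/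
theorem expect_exp_bootstrap_le {Ω : Type*} {n : ℕ} (hn : 0 < n) (a : Ω → ℝ) (D : Fin n → Ω) :
    𝔼 b : Fin n → Fin n, Real.exp (∑ k, a (D (b k))) ≤
      ∏ i, Real.exp (Real.exp (a (D i)) - 1) := by
  have hn0 : (n : ℝ) ≠ 0 := by exact_mod_cast hn.ne'
  have h1 := Finset.expect_pow (Finset.univ : Finset (Fin n)) (fun i => Real.exp (a (D i))) n
  rw [Fintype.piFinset_univ] at h1
  simp only [Real.exp_sum]
  rw [← h1, ← Real.exp_sum, Fintype.expect_eq_sum_div_card, Fintype.card_fin]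
  set x := (∑ i, Real.exp (a (D i))) / n with hx
  have hx0 : 0 ≤ x := by positivity
  have h2 : x ≤ Real.exp (x - 1) := by
    have := Real.add_one_le_exp (x - 1)
    linarith
  calc x ^ n ≤ Real.exp (x - 1) ^ n := pow_le_pow_left₀ hx0 h2 n
    _ = Real.exp (∑ i, (Real.exp (a (D i)) - 1)) := by
      rw [← Real.exp_nat_mul, hx]
      congr 1
      rw [Finset.sum_sub_distrib]
      simp only [Finset.sum_const, Finset.card_univ, Fintype.card_fin, nsmul_eq_mul, mul_one]
      field_simp

theorem integrable_exp_bootstrap {Ω : Type*} [MeasurableSpace Ω] (ρ : Measure Ω)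
    [IsProbabilityMeasure ρ] {n : ℕ} (hn : 0 < n) {a : Ω → ℝ} (ha : Measurable a) {A : ℝ}
    (hA : ∀ᵐ z ∂ρ, a z ≤ A) :
    Integrable (fun D : Fin n → Ω => 𝔼 b : Fin n → Fin n, Real.exp (∑ k, a (D (b k))))
        (Measure.pi fun _ => ρ) ∧
      ∫ D : Fin n → Ω, 𝔼 b : Fin n → Fin n, Real.exp (∑ k, a (D (b k)))
          ∂(Measure.pi fun _ => ρ) ≤ (∫ z, Real.exp (Real.exp (a z) - 1) ∂ρ) ^ n := by
  have hint : Integrable (fun z => Real.exp (Real.exp (a z) - 1)) ρ := by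
    refine Integrable.of_bound (by fun_prop) (Real.exp (Real.exp A - 1)) ?_
    filter_upwards [hA] with z hz
    rw [Real.norm_eq_abs, Real.abs_exp]
    gcongr
  have hprod : Integrable (fun D : Fin n → Ω => ∏ i, Real.exp (Real.exp (a (D i)) - 1))
      (Measure.pi fun _ => ρ) := Integrable.fintype_prod fun _ => hint
  have hnn : ∀ D : Fin n → Ω, 0 ≤ 𝔼 b : Fin n → Fin n, Real.exp (∑ k, a (D (b k))) := fun D =>
    Finset.expect_nonneg fun _ _ => (Real.exp_pos _).le
  have hmeas : Measurable fun D : Fin n → Ω =>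
      𝔼 b : Fin n → Fin n, Real.exp (∑ k, a (D (b k))) := by
    simp only [Fintype.expect_eq_sum_div_card]
    fun_prop
  refine ⟨hprod.mono' hmeas.aestronglyMeasurable (Filter.Eventually.of_forall fun D => ?_), ?_⟩
  · rw [Real.norm_eq_abs, abs_of_nonneg (hnn D)]
    exact expect_exp_bootstrap_le hn a D
  · refine (integral_mono_of_nonneg (Filter.Eventually.of_forall hnn) hprod
      (Filter.Eventually.of_forall fun D => expect_exp_bootstrap_le hn a D)).trans_eq ?_
    rw [integral_fintype_prod_eq_pow (fun z => Real.exp (Real.exp (a z) - 1)), Fintype.card_fin]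

theorem exp_exp_sub_one_le {a : ℝ} (ha : |a| ≤ 1 / 2) :
    Real.exp (Real.exp a - 1) ≤ 1 + a + 5 * a ^ 2 := by
  have h1 := abs_le.1 (Real.abs_exp_sub_one_sub_id_le (x := a) (by linarith))
  set b := Real.exp a - 1 with hb
  have ha2 : a ^ 2 ≤ |a| / 2 := by
    rw [← sq_abs]; nlinarith [abs_nonneg a]
  have hba : |b| ≤ 2 * |a| := by
    refine abs_le.2 ⟨?_, ?_⟩
    · linarith [neg_abs_le a, abs_nonneg a]
    · linarith [le_abs_self a, abs_nonneg a]
  have h2 := (abs_le.1 (Real.abs_exp_sub_one_sub_id_le (x := b) (by linarith))).2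
  have h3 : b ^ 2 ≤ 4 * a ^ 2 := by
    rw [← sq_abs b, ← sq_abs a]
    nlinarith [abs_nonneg b, abs_nonneg a]
  linarith [h1.2]

/-! ### The regression function -/

section Regression

variable {p : ℕ} {ρ : Measure ((Fin p → ℝ) × ℝ)} {μ : (Fin p → ℝ) → ℝ}
  {B : ℝ}

theorem ae_of_ae_fst {Q : (Fin p → ℝ) → Prop} (h : ∀ᵐ x ∂ρ.fst, Q x) : ∀ᵐ z ∂ρ, Q z.1 :=
  ae_of_ae_map measurable_fst.aemeasurable h

theorem IsRegressionFunction.ae_abs_le (hμ : IsRegressionFunction ρ μ)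
    (hY : ∀ᵐ z ∂ρ, |z.2| ≤ B) : ∀ᵐ x ∂ρ.fst, |μ x| ≤ B := by
  have h := ae_bdd_abs_condExp_of_ae_bdd_abs (m := MeasurableSpace.comap Prod.fst inferInstance)
    hY
  refine (ae_map_iff measurable_fst.aemeasurable
    (measurableSet_le hμ.1.abs measurable_const)).2 ?_
  filter_upwards [h, hμ.2] with z h1 h2
  rw [h2]
  exact h1

variable [IsProbabilityMeasure ρ]

theorem integrable_of_ae_abs_le {Ω : Type*} [MeasurableSpace Ω] {ν : Measure Ω} [IsFiniteMeasure ν]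
    {f : Ω → ℝ} (hf : AEMeasurable f ν) {A : ℝ} (h : ∀ᵐ z ∂ν, |f z| ≤ A) : Integrable f ν :=
  Integrable.of_bound hf.aestronglyMeasurable A h

theorem integrable_sub_sq {P : Measure (Fin p → ℝ)} [IsFiniteMeasure P] (hμ : Measurable μ)
    (hμB : ∀ᵐ x ∂P, |μ x| ≤ B) {f : (Fin p → ℝ) → ℝ} (hf : Measurable f)
    (hfB : ∀ x, |f x| ≤ B) : Integrable (fun x => (μ x - f x) ^ 2) P := by
  refine integrable_of_ae_abs_le ((hμ.sub hf).pow_const 2).aemeasurable (A := (2 * B) ^ 2) ?_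
  filter_upwards [hμB] with x h1
  rw [abs_pow]
  refine pow_le_pow_left₀ (abs_nonneg _) ((abs_sub _ _).trans ?_) 2
  linarith [hfB x]

/-- The excess of the squared loss of `h` over that of the regression function. -/
def excessLoss (μ h : (Fin p → ℝ) → ℝ) (z : (Fin p → ℝ) × ℝ) : ℝ :=
  (z.2 - h z.1) ^ 2 - (z.2 - μ z.1) ^ 2

/-- The excess loss is (μ - h)² plus the cross term 2(μ - h)(Y - μ), which integrates to zero by
pulling the function μ - h of X out of the conditional expectation. Almost everywhere measurability
of h suffices, as is needed for functions of bounded variation on the support only. -/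
theorem IsRegressionFunction.integral_excessLoss (hμ : IsRegressionFunction ρ μ)
    (hY : ∀ᵐ z ∂ρ, |z.2| ≤ B) {h : (Fin p → ℝ) → ℝ} (hh : AEMeasurable h ρ.fst) {A : ℝ}
    (hA : ∀ᵐ x ∂ρ.fst, |h x| ≤ A) :
    Integrable (excessLoss μ h) ρ ∧
      ∫ z, excessLoss μ h z ∂ρ = sqNorm ρ.fst fun x => μ x - h x := by
  have hμB := hμ.ae_abs_le hY
  have hqmp : Measure.QuasiMeasurePreserving (Prod.fst : (Fin p → ℝ) × ℝ → _) ρ ρ.fst :=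
    ⟨measurable_fst, by rw [Measure.fst]⟩
  have hφm : AEMeasurable (fun x => μ x - h x) ρ.fst := hμ.1.aemeasurable.sub hh
  have hφb : ∀ᵐ x ∂ρ.fst, |μ x - h x| ≤ B + A := by
    filter_upwards [hμB, hA] with x h1 h2
    exact (abs_sub _ _).trans (add_le_add h1 h2)
  have hφz : AEMeasurable (fun z : (Fin p → ℝ) × ℝ => μ z.1 - h z.1) ρ :=
    hφm.comp_quasiMeasurePreserving hqmp
  have hφzb := ae_of_ae_fst hφb
  have hμz := ae_of_ae_fst hμB
  have iY : Integrable (fun z : (Fin p → ℝ) × ℝ => z.2) ρ :=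
    integrable_of_ae_abs_le measurable_snd.aemeasurable hY
  have i1 : Integrable (fun z : (Fin p → ℝ) × ℝ => (μ z.1 - h z.1) ^ 2) ρ := by
    refine integrable_of_ae_abs_le (hφz.pow_const 2) (A := (B + A) ^ 2) ?_
    filter_upwards [hφzb] with z hz
    rw [abs_pow]
    exact pow_le_pow_left₀ (abs_nonneg _) hz 2
  have i2 : Integrable (fun z : (Fin p → ℝ) × ℝ => (μ z.1 - h z.1) * z.2) ρ := by
    refine integrable_of_ae_abs_le (hφz.mul measurable_snd.aemeasurable) (A := (B + A) * B) ?_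
    filter_upwards [hφzb, hY] with z h1 h2
    rw [abs_mul]
    exact mul_le_mul h1 h2 (abs_nonneg _) ((abs_nonneg _).trans h1)
  have i3 : Integrable (fun z : (Fin p → ℝ) × ℝ => (μ z.1 - h z.1) * μ z.1) ρ := by
    refine integrable_of_ae_abs_le (hφz.mul (hμ.1.comp measurable_fst).aemeasurable)
      (A := (B + A) * B) ?_
    filter_upwards [hφzb, hμz] with z h1 h2
    rw [abs_mul]
    exact mul_le_mul h1 h2 (abs_nonneg _) ((abs_nonneg _).trans h1)
  have e : ∀ z, excessLoss μ h z = (μ z.1 - h z.1) ^ 2 +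
      2 * ((μ z.1 - h z.1) * z.2 - (μ z.1 - h z.1) * μ z.1) := by
    intro z; unfold excessLoss; ring
  have hm : MeasurableSpace.comap (Prod.fst : (Fin p → ℝ) × ℝ → _) inferInstance ≤
      (inferInstance : MeasurableSpace ((Fin p → ℝ) × ℝ)) := measurable_fst.comap_le
  have hzero : ∫ z, (μ z.1 - h z.1) * z.2 ∂ρ = ∫ z, (μ z.1 - h z.1) * μ z.1 ∂ρ := by
    have hsm : AEStronglyMeasurable[MeasurableSpace.comap Prod.fst inferInstance]
        (fun z : (Fin p → ℝ) × ℝ => μ z.1 - h z.1) ρ := by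
      refine ⟨fun z => hφm.mk _ z.1, ?_, ae_of_ae_fst hφm.ae_eq_mk⟩
      exact (hφm.measurable_mk.comp (comap_measurable _)).stronglyMeasurable
    have hc := condExp_stronglyMeasurable_mul_of_bound₀ hm hsm iY (B + A) hφzb
    rw [← integral_condExp hm]
    refine integral_congr_ae ?_
    filter_upwards [hc, hμ.2] with z h1 h2
    refine h1.trans ?_
    rw [Pi.mul_apply, h2]
  have i4 : Integrable (fun z : (Fin p → ℝ) × ℝ =>
      2 * ((μ z.1 - h z.1) * z.2 - (μ z.1 - h z.1) * μ z.1)) ρ := (i2.sub i3).const_mul 2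
  constructor
  · exact (i1.add i4).congr (Filter.Eventually.of_forall fun z => (e z).symm)
  · simp only [e]
    rw [integral_add i1 i4, integral_const_mul, integral_sub i2 i3, hzero,
      sub_self, mul_zero, add_zero, sqNorm, Measure.fst,
      integral_map measurable_fst.aemeasurable]
    exact (hφm.pow_const 2).aestronglyMeasurable

/-- A Bernstein-type bound: the excess loss factors as (μ - f)(2Y - f - μ), so its square is at most
16B²(μ - f)². The quadratic term then consumes only half of the linear one. -/
theorem IsRegressionFunction.integral_exp_excessLoss_le (hμ : IsRegressionFunction ρ μ)
    (hB : 0 < B) (hY : ∀ᵐ z ∂ρ, |z.2| ≤ B) {f : (Fin p → ℝ) → ℝ} (hf : Measurable f)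
    (hfB : ∀ x, |f x| ≤ B) {c : ℝ} (hc : c = 1 / (160 * B ^ 2)) :
    (∀ᵐ z ∂ρ, -c * excessLoss μ f z ≤ 1 / 2) ∧
      ∫ z, Real.exp (Real.exp (-c * excessLoss μ f z) - 1) ∂ρ ≤
        Real.exp (-(c * (sqNorm ρ.fst fun x => μ x - f x) / 2)) := by
  have hμz := ae_of_ae_fst (hμ.ae_abs_le hY)
  obtain ⟨hi, he⟩ := hμ.integral_excessLoss hY hf.aemeasurable
    (Filter.Eventually.of_forall hfB)
  have hc0 : 0 < c := by rw [hc]; positivity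
  have hcB : c * (8 * B ^ 2) ≤ 1 / 2 := by rw [hc]; field_simp; norm_num
  have hmain : ∀ᵐ z ∂ρ, |-c * excessLoss μ f z| ≤ 1 / 2 ∧
      Real.exp (Real.exp (-c * excessLoss μ f z) - 1) ≤
        1 - c * excessLoss μ f z + c / 2 * (μ z.1 - f z.1) ^ 2 := by
    filter_upwards [hμz, hY] with z h1 h2
    have e : excessLoss μ f z = (μ z.1 - f z.1) * (2 * z.2 - f z.1 - μ z.1) := by
      unfold excessLoss; ring
    have b1 : |2 * z.2 - f z.1 - μ z.1| ≤ 4 * B := by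
      have h3 := abs_le.1 (hfB z.1)
      have h4 := abs_le.1 h1
      have h5 := abs_le.1 h2
      exact abs_le.2 ⟨by linarith, by linarith⟩
    have b2 : |μ z.1 - f z.1| ≤ 2 * B := by
      have h3 := abs_le.1 (hfB z.1)
      have h4 := abs_le.1 h1
      exact abs_le.2 ⟨by linarith, by linarith⟩
    have b3 : |excessLoss μ f z| ≤ 8 * B ^ 2 := by
      rw [e, abs_mul]
      calc _ ≤ 2 * B * (4 * B) := mul_le_mul b2 b1 (abs_nonneg _) (by positivity)
        _ = _ := by ring
    have b4 : excessLoss μ f z ^ 2 ≤ 16 * B ^ 2 * (μ z.1 - f z.1) ^ 2 := by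
      rw [e, mul_pow]
      have : (2 * z.2 - f z.1 - μ z.1) ^ 2 ≤ (4 * B) ^ 2 := by
        rw [← sq_abs]; exact pow_le_pow_left₀ (abs_nonneg _) b1 2
      nlinarith [sq_nonneg (μ z.1 - f z.1)]
    have b5 : |-c * excessLoss μ f z| ≤ 1 / 2 := by
      rw [abs_mul, abs_neg, abs_of_pos hc0]
      exact (mul_le_mul_of_nonneg_left b3 hc0.le).trans hcB
    refine ⟨b5, (exp_exp_sub_one_le b5).trans ?_⟩
    -- The value of c is chosen so that 5c² · 16B² = c/2.
    have b6 : 5 * (-c * excessLoss μ f z) ^ 2 ≤ c / 2 * (μ z.1 - f z.1) ^ 2 := by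
      calc _ = 5 * c ^ 2 * excessLoss μ f z ^ 2 := by ring
        _ ≤ 5 * c ^ 2 * (16 * B ^ 2 * (μ z.1 - f z.1) ^ 2) := by gcongr
        _ = c / 2 * (μ z.1 - f z.1) ^ 2 := by rw [hc]; field_simp; ring
    linarith
  refine ⟨hmain.mono fun z hz => (le_abs_self _).trans hz.1, ?_⟩
  have hsq := integrable_sub_sq hμ.1 (hμ.ae_abs_le hY) hf hfB
  have hsq' : Integrable (fun z : (Fin p → ℝ) × ℝ => (μ z.1 - f z.1) ^ 2) ρ :=
    hsq.comp_measurable measurable_fst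
  have hsqe : ∫ z, (μ z.1 - f z.1) ^ 2 ∂ρ = sqNorm ρ.fst fun x => μ x - f x := by
    rw [sqNorm, Measure.fst, integral_map measurable_fst.aemeasurable]
    exact hsq.aestronglyMeasurable
  have i1 : Integrable (fun z => 1 - c * excessLoss μ f z) ρ :=
    (integrable_const 1).sub (hi.const_mul c)
  calc _ ≤ ∫ z, (1 - c * excessLoss μ f z + c / 2 * (μ z.1 - f z.1) ^ 2) ∂ρ :=
        integral_mono_of_nonneg (Filter.Eventually.of_forall fun z => (Real.exp_pos _).le)
          (i1.add (hsq'.const_mul _)) (hmain.mono fun z hz => hz.2)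
    _ = 1 - c * (sqNorm ρ.fst fun x => μ x - f x) / 2 := by
        rw [integral_add i1 (hsq'.const_mul _), integral_sub (integrable_const 1)
          (hi.const_mul c), integral_const_mul, integral_const_mul, he, hsqe]
        simp
        ring
    _ ≤ _ := by
        have := Real.add_one_le_exp (-(c * (sqNorm ρ.fst fun x => μ x - f x) / 2))
        linarith

end Regression

/-! ### From the training error to the risk -/

section Generalization

variable {n p : ℕ} {ρ : Measure ((Fin p → ℝ) × ℝ)} [IsProbabilityMeasure ρ] {μ : (Fin p → ℝ) → ℝ}
  {B : ℝ}

/-- The sum of the exponential deviations of the functions in `F`. -/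
noncomputable def expDeviation (ρ : Measure ((Fin p → ℝ) × ℝ)) (μ : (Fin p → ℝ) → ℝ) (c : ℝ)
    (F : Finset ((Fin p → ℝ) → ℝ)) (Z : Sample n p) : ℝ :=
  ∑ f ∈ F, Real.exp (c * (n * (sqNorm ρ.fst fun x => μ x - f x) / 2)) *
    Real.exp (∑ k, -c * excessLoss μ f (Z k))

/-- The sum of the exponentials of the numbers of sample points in the sets `E i`. -/
noncomputable def expCount {ι : Type*} [Fintype ι] (E : ι → Set (Fin p → ℝ)) (Z : Sample n p) : ℝ :=
  ∑ i, Real.exp (∑ k, (E i).indicator (fun _ => (1 : ℝ)) (Z k).1)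

/-- The normalizing factor exp(c n ‖μ - f‖²/2) exactly offsets the bound on the n-fold exponential
moment, so each f contributes at most 1. This is the union bound in exponential form. -/
theorem IsRegressionFunction.integral_expDeviation_le (hμ : IsRegressionFunction ρ μ)
    (hB : 0 < B) (hY : ∀ᵐ z ∂ρ, |z.2| ≤ B) (hn : 0 < n) {F : Finset ((Fin p → ℝ) → ℝ)}
    (hF : ∀ f ∈ F, Measurable f) (hFB : ∀ f ∈ F, ∀ x, |f x| ≤ B) :
    Integrable (fun D : Sample n p => 𝔼 b : Fin n → Fin n,
        expDeviation ρ μ (1 / (160 * B ^ 2)) F fun k => D (b k)) (Measure.pi fun _ => ρ) ∧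
      ∫ D : Sample n p, 𝔼 b : Fin n → Fin n,
        expDeviation ρ μ (1 / (160 * B ^ 2)) F (fun k => D (b k)) ∂(Measure.pi fun _ => ρ) ≤
          F.card := by
  set c := 1 / (160 * B ^ 2) with hc
  have hterm : ∀ f ∈ F, _ := fun f hf =>
    integrable_exp_bootstrap ρ hn (a := fun z => -c * excessLoss μ f z)
      (by
        have := hμ.1
        have := hF f hf
        unfold excessLoss
        fun_prop)
      (hμ.integral_exp_excessLoss_le hB hY (hF f hf) (hFB f hf) hc).1
  have e : ∀ D : Sample n p, 𝔼 b : Fin n → Fin n, expDeviation ρ μ c F (fun k => D (b k)) =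
      ∑ f ∈ F, Real.exp (c * (n * (sqNorm ρ.fst fun x => μ x - f x) / 2)) *
        𝔼 b : Fin n → Fin n, Real.exp (∑ k, -c * excessLoss μ f (D (b k))) := by
    intro D
    simp only [expDeviation, Finset.expect_sum_comm, ← Finset.mul_expect]
  simp only [e]
  have hint : ∀ f ∈ F, Integrable (fun D : Sample n p =>
      Real.exp (c * (n * (sqNorm ρ.fst fun x => μ x - f x) / 2)) *
        𝔼 b : Fin n → Fin n, Real.exp (∑ k, -c * excessLoss μ f (D (b k))))
      (Measure.pi fun _ => ρ) := fun f hf => (hterm f hf).1.const_mul _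
  refine ⟨integrable_finsetSum _ hint, ?_⟩
  rw [integral_finsetSum _ hint]
  calc _ ≤ ∑ f ∈ F, (1 : ℝ) := Finset.sum_le_sum fun f hf => ?_
    _ = F.card := by simp
  rw [integral_const_mul]
  have h1 := (hterm f hf).2.trans (pow_le_pow_left₀
    (integral_nonneg fun _ => (Real.exp_pos _).le)
    (hμ.integral_exp_excessLoss_le hB hY (hF f hf) (hFB f hf) hc).2 n)
  refine (mul_le_mul_of_nonneg_left h1 (Real.exp_pos _).le).trans_eq ?_
  rw [← Real.exp_nat_mul, ← Real.exp_add, Real.exp_eq_one_iff]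
  ring

/-- Controls the number of bootstrap points in all exceptional sets at once. With probability at
most 1/n per point, each exponential moment is at most (1 + γ/n)^n ≤ exp γ, where exp(exp 1 - 1) = 1
+ γ is the Poissonized value on the set. -/
theorem integral_expCount_le (hn : 0 < n) {ι : Type*} [Fintype ι] {E : ι → Set (Fin p → ℝ)}
    (hE : ∀ i, MeasurableSet (E i)) (hEn : ∀ i, ρ.fst.real (E i) ≤ 1 / n) :
    Integrable (fun D : Sample n p => 𝔼 b : Fin n → Fin n, expCount E fun k => D (b k))
        (Measure.pi fun _ => ρ) ∧
      ∫ D : Sample n p, 𝔼 b : Fin n → Fin n, expCount E (fun k => D (b k))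
        ∂(Measure.pi fun _ => ρ) ≤
          Fintype.card ι * Real.exp (Real.exp (Real.exp 1 - 1) - 1) := by
  have hn0 : (0 : ℝ) < n := by exact_mod_cast hn
  set γ := Real.exp (Real.exp 1 - 1) - 1 with hγ
  have hγ0 : 0 ≤ γ := by
    have h1 := Real.add_one_le_exp (1 : ℝ)
    have h2 := Real.add_one_le_exp (Real.exp 1 - 1)
    linarith
  have hEm : ∀ i, MeasurableSet ((Prod.fst : (Fin p → ℝ) × ℝ → _) ⁻¹' E i) := fun i =>
    measurable_fst (hE i)
  have hEρ : ∀ i, ρ.real ((Prod.fst : (Fin p → ℝ) × ℝ → _) ⁻¹' E i) ≤ 1 / n := fun i => by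
    rw [← map_measureReal_apply measurable_fst (hE i)]
    exact hEn i
  have hterm := fun i => integrable_exp_bootstrap ρ hn
    (a := fun z => (E i).indicator (fun _ => (1 : ℝ)) z.1) (A := 1)
    ((measurable_const.indicator (hE i)).comp measurable_fst)
    (Filter.Eventually.of_forall fun z => Set.indicator_le' (fun _ _ => le_rfl)
      (fun _ _ => zero_le_one) z.1)
  simp only [expCount, Finset.expect_sum_comm]
  refine ⟨integrable_finsetSum _ fun i _ => (hterm i).1, ?_⟩
  rw [integral_finsetSum _ fun i _ => (hterm i).1]
  calc _ ≤ ∑ i : ι, Real.exp γ := Finset.sum_le_sum fun i _ => (hterm i).2.trans ?_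
    _ = _ := by simp
  have e : ∀ z : (Fin p → ℝ) × ℝ,
      Real.exp (Real.exp ((E i).indicator (fun _ => (1 : ℝ)) z.1) - 1) =
        1 + γ * (Prod.fst ⁻¹' E i).indicator (fun _ => (1 : ℝ)) z := by
    intro z
    by_cases hz : z.1 ∈ E i
    · rw [Set.indicator_of_mem hz, Set.indicator_of_mem (show z ∈ Prod.fst ⁻¹' E i from hz)]
      rw [hγ]; ring
    · rw [Set.indicator_of_notMem hz,
        Set.indicator_of_notMem (show z ∉ Prod.fst ⁻¹' E i from hz)]
      simp
  have h1 : ∫ z, Real.exp (Real.exp ((E i).indicator (fun _ => (1 : ℝ)) z.1) - 1) ∂ρ ≤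
      Real.exp (γ / n) := by
    simp only [e]
    rw [integral_add (integrable_const 1)
      (((integrable_const (1 : ℝ)).indicator (hEm i)).const_mul γ), integral_const_mul,
      integral_indicator_const _ (hEm i)]
    have h2 := mul_le_mul_of_nonneg_left (hEρ i) hγ0
    have h3 := Real.add_one_le_exp (γ / n)
    rw [mul_one_div] at h2
    simp only [smul_eq_mul, mul_one, integral_const, probReal_univ]
    linarith
  calc _ ≤ Real.exp (γ / n) ^ n :=
        pow_le_pow_left₀ (integral_nonneg fun _ => (Real.exp_pos _).le) h1 n
    _ = Real.exp γ := by rw [← Real.exp_nat_mul, mul_div_cancel₀ _ hn0.ne']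

theorem residualSS_sub_residualSS (Z : Sample n p) (h : (Fin p → ℝ) → ℝ) :
    residualSS Z Set.univ h - residualSS Z Set.univ μ = ∑ k, excessLoss μ h (Z k) := by
  have : members Z Set.univ = Finset.univ := by ext; simp [mem_members]
  rw [residualSS, residualSS, this, ← Finset.sum_sub_distrib]
  rfl

theorem abs_sq_sub_sq_le {y a b : ℝ} (hy : |y| ≤ B) (ha : |a| ≤ B) (hb : |b| ≤ B) :
    |(y - a) ^ 2 - (y - b) ^ 2| ≤ 4 * B * |a - b| := by
  have e : (y - a) ^ 2 - (y - b) ^ 2 = (2 * y - a - b) * (b - a) := by ring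
  rw [e, abs_mul, abs_sub_comm b a]
  refine mul_le_mul_of_nonneg_right ?_ (abs_nonneg _)
  obtain ⟨h1, h2⟩ := abs_le.1 hy
  obtain ⟨h3, h4⟩ := abs_le.1 ha
  obtain ⟨h5, h6⟩ := abs_le.1 hb
  exact abs_le.2 ⟨by linarith, by linarith⟩

theorem integrable_list_sum {P : Measure (Fin p → ℝ)} [IsFiniteMeasure P] {ι : Type*}
    {E : ι → Set (Fin p → ℝ)} (hE : ∀ i, MeasurableSet (E i)) {a : ℝ}
    (hEa : ∀ i, P.real (E i) ≤ a) (l : List ι) :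
    Integrable (fun x => (l.map fun i => (E i).indicator (fun _ => (1 : ℝ)) x).sum) P ∧
      ∫ x, (l.map fun i => (E i).indicator (fun _ => (1 : ℝ)) x).sum ∂P ≤ l.length * a := by
  induction l with
  | nil => simp
  | cons i l ih =>
    have hi : Integrable (fun x => (E i).indicator (fun _ => (1 : ℝ)) x) P :=
      (integrable_const (1 : ℝ)).indicator (hE i)
    simp only [List.map_cons, List.sum_cons]
    refine ⟨hi.add ih.1, ?_⟩
    rw [integral_add hi ih.1, integral_indicator_const _ (hE i), List.length_cons]
    have := ih.2
    have := hEa i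
    push_cast
    simp only [smul_eq_mul, mul_one]
    linarith

theorem sum_list_sum_le {ι : Type*} (φ : ι → Fin n → ℝ) {a : ℝ} (l : List ι)
    (h : ∀ i ∈ l, ∑ k, φ i k ≤ a) : ∑ k, (l.map fun i => φ i k).sum ≤ l.length * a := by
  induction l with
  | nil => simp
  | cons i l ih =>
    simp only [List.map_cons, List.sum_cons, Finset.sum_add_distrib, List.length_cons]
    have h1 := ih fun j hj => h j (List.mem_cons_of_mem _ hj)
    have h2 := h i List.mem_cons_self
    push_cast
    linarith

/-- The risk of a tree is bounded by its training error and the exponential deviations. -/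
theorem IsRegressionFunction.sqNorm_sub_grow_le (hμ : IsRegressionFunction ρ μ)
    (hB : 0 < B) (hY : ∀ᵐ z ∂ρ, |z.2| ≤ B) (hn : 0 < n) {ι : Type*} [Fintype ι] [Nonempty ι]
    {H E : ι → Set (Fin p → ℝ)} (hH : ∀ i, MeasurableSet (H i)) (hE : ∀ i, MeasurableSet (E i))
    (hEn : ∀ i, ρ.fst.real (E i) ≤ 1 / n)
    (hHE : ∀ c : Split p, ∃ i, ∀ x ∉ E i, (x c.1 ≤ c.2 ↔ x ∈ H i))
    (rule : SplitRule n p) {Z : Sample n p} (hZ : ∀ i, |(Z i).2| ≤ B) {q K : ℕ}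
    (ξ : Draws p q K) (hmeas : Measurable (grow rule Z K ξ Set.univ)) :
    (sqNorm ρ.fst fun x => μ x - grow rule Z K ξ Set.univ x) ≤
      2 / n * ∑ k, excessLoss μ (grow rule Z K ξ Set.univ) (Z k) +
        (16 * B ^ 2 * 2 ^ K + 320 * B ^ 2 * Real.log (expDeviation ρ μ (1 / (160 * B ^ 2))
          (treeClass H (leafGrid B n) K) Z) + 16 * B ^ 2 * 2 ^ K * Real.log (expCount E Z)) / n := by
  have hn0 : (0 : ℝ) < n := by exact_mod_cast hn
  have hμB := hμ.ae_abs_le hY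
  set T := grow rule Z K ξ Set.univ
  have hTB : ∀ x, |T x| ≤ B := abs_grow_le rule hB.le hZ K ξ Set.univ
  set F := treeClass H (leafGrid B n) K
  obtain ⟨f, hfF, l, hl, happ⟩ := exists_treeClass_approx rule hB.le
    (div_nonneg hB.le hn0.le) hZ (fun w hw => abs_le_of_mem_leafGrid hB hn hw)
    (fun v hv => exists_mem_leafGrid hB hn hv) hHE K ξ Set.univ
  change ∀ x, |T x - f x| ≤ _ at happ
  have hfB : ∀ x, |f x| ≤ B :=
    abs_le_of_mem_treeClass (fun w hw => abs_le_of_mem_leafGrid hB hn hw) f hfF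
  have hfm : Measurable f := measurable_of_mem_treeClass hH f hfF
  have hlen : (l.length : ℝ) + 1 ≤ 2 ^ K := by exact_mod_cast hl
  set c := 1 / (160 * B ^ 2) with hc
  have hc0 : 0 < c := by positivity
  set m := sqNorm ρ.fst fun x => μ x - f x with hm
  set W₁ := expDeviation ρ μ c F Z
  set W₂ := expCount E Z
  -- the population risks of the tree and of its approximation
  have s1 : (sqNorm ρ.fst fun x => μ x - T x) ≤ m + 8 * B ^ 2 * 2 ^ K / n := by
    obtain ⟨hi, hi'⟩ := integrable_list_sum hE hEn l
    have hi2 : Integrable (fun x => 4 * B * (B / n + 2 * B *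
        (l.map fun i => (E i).indicator (fun _ => (1 : ℝ)) x).sum)) ρ.fst :=
      ((integrable_const _).add (hi.const_mul _)).const_mul _
    have h1 : ∫ x, ((μ x - T x) ^ 2 - (μ x - f x) ^ 2) ∂ρ.fst ≤
        ∫ x, 4 * B * (B / n + 2 * B *
          (l.map fun i => (E i).indicator (fun _ => (1 : ℝ)) x).sum) ∂ρ.fst := by
      refine integral_mono_ae ((integrable_sub_sq hμ.1 hμB hmeas hTB).sub
        (integrable_sub_sq hμ.1 hμB hfm hfB)) hi2 ?_
      filter_upwards [hμB] with x hx
      refine (le_abs_self _).trans ((abs_sq_sub_sq_le hx (hTB x) (hfB x)).trans ?_)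
      exact mul_le_mul_of_nonneg_left (happ x) (by positivity)
    rw [integral_sub (integrable_sub_sq hμ.1 hμB hmeas hTB)
      (integrable_sub_sq hμ.1 hμB hfm hfB), integral_const_mul,
      integral_add (integrable_const _) (hi.const_mul _), integral_const_mul] at h1
    simp only [integral_const, probReal_univ, smul_eq_mul, one_mul] at h1
    have h2 : 4 * B * (B / n + 2 * B *
        ∫ x, (l.map fun i => (E i).indicator (fun _ => (1 : ℝ)) x).sum ∂ρ.fst) ≤
        8 * B ^ 2 * 2 ^ K / n := by
      calc _ ≤ 4 * B * (B / n + 2 * B * (l.length * (1 / n))) := by gcongr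
        _ = 8 * B ^ 2 * (l.length + 1 / 2) / n := by ring
        _ ≤ _ := by gcongr; linarith
    unfold sqNorm at hm ⊢
    linarith
  -- the deviation of the approximation
  have s2 : m ≤ 2 / n * ∑ k, excessLoss μ f (Z k) + 320 * B ^ 2 * Real.log W₁ / n := by
    have h1 : Real.exp (c * (n * m / 2)) * Real.exp (∑ k, -c * excessLoss μ f (Z k)) ≤ W₁ :=
      Finset.single_le_sum (f := fun f => Real.exp (c * (n * (sqNorm ρ.fst fun x =>
        μ x - f x) / 2)) * Real.exp (∑ k, -c * excessLoss μ f (Z k)))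
        (fun _ _ => by positivity) hfF
    rw [← Real.exp_add] at h1
    have h2 := (Real.le_log_iff_exp_le ((Real.exp_pos _).trans_le h1)).2 h1
    rw [← Finset.mul_sum] at h2
    -- The multiplier 320B²/n equals 2/(cn); it makes the coefficient of m equal to 1.
    have h3 := mul_le_mul_of_nonneg_left h2 (by positivity : 0 ≤ 320 * B ^ 2 / n)
    have h4 : 320 * B ^ 2 / n * (c * (n * m / 2) + -c * ∑ k, excessLoss μ f (Z k)) =
        m - 2 / n * ∑ k, excessLoss μ f (Z k) := by
      rw [hc]; field_simp; ring
    rw [h4] at h3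
    have h5 : 320 * B ^ 2 / n * Real.log W₁ = 320 * B ^ 2 * Real.log W₁ / n := by ring
    linarith
  -- the training errors of the tree and of its approximation
  have hcount : ∀ i, ∑ k, (E i).indicator (fun _ => (1 : ℝ)) (Z k).1 ≤ Real.log W₂ := by
    intro i
    have h1 : Real.exp (∑ k, (E i).indicator (fun _ => (1 : ℝ)) (Z k).1) ≤ W₂ :=
      Finset.single_le_sum
        (f := fun i => Real.exp (∑ k, (E i).indicator (fun _ => (1 : ℝ)) (Z k).1))
        (fun _ _ => (Real.exp_pos _).le) (Finset.mem_univ i)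
    exact (Real.le_log_iff_exp_le ((Real.exp_pos _).trans_le h1)).2 h1
  have hW₂ : 0 ≤ Real.log W₂ := (Finset.sum_nonneg fun k _ =>
    Set.indicator_nonneg (fun _ _ => zero_le_one) _).trans (hcount (Classical.arbitrary ι))
  have s3 : ∑ k, excessLoss μ f (Z k) ≤ ∑ k, excessLoss μ T (Z k) +
      (4 * B ^ 2 + 8 * B ^ 2 * 2 ^ K * Real.log W₂) := by
    have h1 : ∑ k, (excessLoss μ f (Z k) - excessLoss μ T (Z k)) ≤
        ∑ k, 4 * B * (B / n + 2 * B *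
          (l.map fun i => (E i).indicator (fun _ => (1 : ℝ)) (Z k).1).sum) := by
      refine Finset.sum_le_sum fun k _ => ?_
      have h2 := abs_sq_sub_sq_le (hZ k) (hfB (Z k).1) (hTB (Z k).1)
      have h3 : excessLoss μ f (Z k) - excessLoss μ T (Z k) =
          ((Z k).2 - f (Z k).1) ^ 2 - ((Z k).2 - T (Z k).1) ^ 2 := by
        unfold excessLoss; ring
      rw [h3]
      refine (le_abs_self _).trans (h2.trans ?_)
      rw [abs_sub_comm]
      exact mul_le_mul_of_nonneg_left (happ _) (by positivity)
    have h4 := sum_list_sum_le (fun i k => (E i).indicator (fun _ => (1 : ℝ)) (Z k).1) l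
      fun i _ => hcount i
    rw [Finset.sum_sub_distrib, ← Finset.mul_sum, Finset.sum_add_distrib, ← Finset.mul_sum] at h1
    simp only [Finset.sum_const, Finset.card_univ, Fintype.card_fin, nsmul_eq_mul] at h1
    have h5 : 4 * B * (n * (B / n) + 2 * B *
        ∑ k, (l.map fun i => (E i).indicator (fun _ => (1 : ℝ)) (Z k).1).sum) ≤
        4 * B ^ 2 + 8 * B ^ 2 * 2 ^ K * Real.log W₂ := by
      rw [mul_div_cancel₀ _ hn0.ne']
      calc _ ≤ 4 * B * (B + 2 * B * (2 ^ K * Real.log W₂)) := by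
            gcongr
            refine h4.trans (mul_le_mul_of_nonneg_right ?_ hW₂)
            linarith
        _ = _ := by ring
    linarith
  have s4 := mul_le_mul_of_nonneg_left s3 (by positivity : 0 ≤ 2 / (n : ℝ))
  have s5 : 8 * B ^ 2 / n ≤ 8 * B ^ 2 * 2 ^ K / n := by
    exact div_le_div_of_nonneg_right
      (le_mul_of_one_le_right (by positivity) (one_le_pow₀ (by norm_num))) hn0.le
  have e1 : 2 / n * (∑ k, excessLoss μ T (Z k) +
      (4 * B ^ 2 + 8 * B ^ 2 * 2 ^ K * Real.log W₂)) = 2 / n * ∑ k, excessLoss μ T (Z k) +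
      8 * B ^ 2 / n + 16 * B ^ 2 * 2 ^ K * Real.log W₂ / n := by ring
  have e2 : (16 * B ^ 2 * 2 ^ K + 320 * B ^ 2 * Real.log W₁ +
      16 * B ^ 2 * 2 ^ K * Real.log W₂) / n = 8 * B ^ 2 * 2 ^ K / n + 8 * B ^ 2 * 2 ^ K / n +
      320 * B ^ 2 * Real.log W₁ / n + 16 * B ^ 2 * 2 ^ K * Real.log W₂ / n := by ring
  rw [e1] at s4
  rw [e2]
  linarith

end Generalization

/-! ### Functions of bounded variation on the support -/

/-- The support is closed and has full measure, and on it f is a difference of monotone functions.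
Off the support f is arbitrary. -/
theorem aemeasurable_of_eVariationOn_support {ν : Measure ℝ} [IsProbabilityMeasure ν] {f : ℝ → ℝ}
    (hf : eVariationOn f ν.support ≠ ⊤) :
    AEMeasurable f ν ∧ ∃ A, ∀ᵐ x ∂ν, |f x| ≤ A := by
  have hs : ∀ᵐ x ∂ν, x ∈ ν.support := Measure.support_mem_ae
  have hbv : BoundedVariationOn f ν.support := hf
  constructor
  · obtain ⟨u, v, hu, hv, rfl⟩ :=
      hbv.locallyBoundedVariationOn.exists_monotoneOn_sub_monotoneOn
    have hm : MeasurableSet ν.support := Measure.isClosed_support.measurableSet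
    have h := (aemeasurable_restrict_of_monotoneOn (μ := ν) hm hu).sub
      (aemeasurable_restrict_of_monotoneOn (μ := ν) hm hv)
    rwa [Measure.restrict_eq_self_of_ae_mem hs] at h
  · obtain ⟨a, ha⟩ := hs.exists
    refine ⟨|f a| + (eVariationOn f ν.support).toReal, ?_⟩
    filter_upwards [hs] with x hx
    have h := hbv.dist_le hx ha
    rw [Real.dist_eq] at h
    have := abs_sub_abs_le_abs_sub (f x) (f a)
    linarith

theorem aemeasurable_of_isAdditiveRep {p : ℕ} {P : Measure (Fin p → ℝ)} [IsProbabilityMeasure P]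
    {g : (Fin p → ℝ) → ℝ} {f : Fin p → ℝ → ℝ} (hg : IsAdditiveRep P g f)
    (hf : ∀ j, coordVariation P j (f j) ≠ ⊤) :
    AEMeasurable g P ∧ ∃ A, ∀ᵐ x ∂P, |g x| ≤ A := by
  have hm : ∀ j : Fin p, Measurable fun x : Fin p → ℝ => x j := fun j => measurable_pi_apply j
  have hprob : ∀ j : Fin p, IsProbabilityMeasure (P.map fun x => x j) := fun j =>
    Measure.isProbabilityMeasure_map (hm j).aemeasurable
  have h1 := fun j => aemeasurable_of_eVariationOn_support (hf j)
  choose h2 A hA using h1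
  constructor
  · refine AEMeasurable.congr ?_ hg.symm
    exact Finset.aemeasurable_fun_sum _ fun j _ => (h2 j).comp_measurable (hm j)
  · refine ⟨∑ j, A j, ?_⟩
    have h3 : ∀ᵐ x ∂P, ∀ j, |f j (x j)| ≤ A j :=
      ae_all_iff.2 fun j => ae_of_ae_map (hm j).aemeasurable (hA j)
    filter_upwards [hg, h3] with x h4 h5
    rw [h4]
    exact (Finset.abs_sum_le_sum_abs _ _).trans (Finset.sum_le_sum fun j _ => h5 j)

/-! ### The risk of a forest -/

/-- The tangent of the logarithm at N. If W has mean at most N, the right side has mean at most log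
N; being affine in W, it can be averaged over draws, bootstrap and data without Jensen's inequality.
-/
theorem log_le_log_add_div {N W : ℝ} (hN : 0 < N) (hW : 0 < W) :
    Real.log W ≤ Real.log N + W / N - 1 := by
  have := Real.log_le_sub_one_of_pos (div_pos hW hN)
  rw [Real.log_div hW.ne' hN.ne'] at this
  linarith

theorem ae_pi_sample {Ω : Type*} [MeasurableSpace Ω] (ρ : Measure Ω) [IsProbabilityMeasure ρ]
    {n : ℕ} {Q : Ω → Prop} (h : ∀ᵐ z ∂ρ, Q z) :
    ∀ᵐ D : Fin n → Ω ∂(Measure.pi fun _ => ρ), ∀ i, Q (D i) :=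
  ae_all_iff.2 fun i =>
    (measurePreserving_eval (fun _ : Fin n => ρ) i).quasiMeasurePreserving.ae h

theorem expect_sum_bootstrap {Ω : Type*} {n : ℕ} (hn : 0 < n) (h : Ω → ℝ) (D : Fin n → Ω) :
    𝔼 b : Fin n → Fin n, ∑ k, h (D (b k)) = ∑ i, h (D i) := by
  have : NeZero n := ⟨hn.ne'⟩
  rw [Finset.expect_sum_comm]
  simp only [fun k => expect_apply_coord k fun i : Fin n => h (D i)]
  rw [Finset.sum_const, Finset.card_univ, Fintype.card_smul_expect]

section Risk

variable {n p q K : ℕ} {ρ : Measure ((Fin p → ℝ) × ℝ)} [IsProbabilityMeasure ρ]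
  {μ : (Fin p → ℝ) → ℝ} {B : ℝ} {rule : SplitRule n p}

theorem abs_treeOutput_le (hB : 0 ≤ B) {D : Sample n p} (hD : ∀ i, |(D i).2| ≤ B)
    (θ : Theta n p q K) (x : Fin p → ℝ) : |treeOutput rule θ D x| ≤ B :=
  abs_grow_le rule hB (fun k => hD (θ.1 k)) K θ.2 Set.univ x

theorem integrable_sqNorm_sub_treeOutput (hB : 0 ≤ B) (hY : ∀ᵐ z ∂ρ, |z.2| ≤ B)
    (hμ : IsRegressionFunction ρ μ) (θ : Theta n p q K)
    (hmeas : Measurable fun z : Sample n p × (Fin p → ℝ) => treeOutput rule θ z.1 z.2) :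
    Integrable (fun D : Sample n p => sqNorm ρ.fst fun x => μ x - treeOutput rule θ D x)
      (Measure.pi fun _ => ρ) := by
  have hm : Measurable fun z : Sample n p × (Fin p → ℝ) => (μ z.2 - treeOutput rule θ z.1 z.2) ^ 2 :=
    ((hμ.1.comp measurable_snd).sub hmeas).pow_const 2
  have hsm := hm.stronglyMeasurable.integral_prod_right' (ν := ρ.fst)
  refine Integrable.of_bound hsm.aestronglyMeasurable ((2 * B) ^ 2) ?_
  filter_upwards [ae_pi_sample ρ hY] with D hD
  have h0 : 0 ≤ ∫ x, (μ x - treeOutput rule θ D x) ^ 2 ∂ρ.fst := integral_nonneg fun _ => sq_nonneg _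
  rw [Real.norm_eq_abs, sqNorm, abs_of_nonneg h0]
  have h1 : ∫ x, (μ x - treeOutput rule θ D x) ^ 2 ∂ρ.fst ≤ ∫ _, (2 * B) ^ 2 ∂ρ.fst := by
    refine integral_mono_of_nonneg (Filter.Eventually.of_forall fun _ => sq_nonneg _)
      (integrable_const _) ?_
    filter_upwards [hμ.ae_abs_le hY] with x hx
    rw [← sq_abs]
    refine pow_le_pow_left₀ (abs_nonneg _) ((abs_sub _ _).trans ?_) 2
    linarith [abs_treeOutput_le (rule := rule) hB hD θ x]
  simpa using h1

/-- Convexity of the square, pointwise in x; each tree of the forest has the law of a single one. -/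
theorem expectedRisk_le_expect {M : ℕ} (hM : 1 ≤ M) (hn : 0 < n) (hqp : q ≤ p) (hB : 0 ≤ B)
    (hY : ∀ᵐ z ∂ρ, |z.2| ≤ B) (hμ : IsRegressionFunction ρ μ)
    (hmeas : ∀ θ : Theta n p q K,
      Measurable fun z : Sample n p × (Fin p → ℝ) => treeOutput rule θ z.1 z.2) :
    expectedRisk q K M rule ρ μ ≤ 𝔼 θ : Theta n p q K,
      ∫ D : Sample n p, sqNorm ρ.fst (fun x => μ x - treeOutput rule θ D x)
        ∂(Measure.pi fun _ => ρ) := by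
  have := nonempty_qSubset hqp
  have : NeZero n := ⟨hn.ne'⟩
  have hM0 : (0 : ℝ) < M := by exact_mod_cast hM
  set R : Theta n p q K → ℝ := fun θ =>
    ∫ D : Sample n p, sqNorm ρ.fst (fun x => μ x - treeOutput rule θ D x)
      ∂(Measure.pi fun _ => ρ) with hR
  have hint := fun θ => integrable_sqNorm_sub_treeOutput hB hY hμ θ (hmeas θ)
  have hΘ : ∀ Θ : Fin M → Theta n p q K,
      ∫ D : Sample n p, sqNorm ρ.fst (fun x => μ x - forestOutput rule Θ D x)
        ∂(Measure.pi fun _ => ρ) ≤ (M : ℝ)⁻¹ * ∑ m, R (Θ m) := by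
    intro Θ
    rw [hR, ← integral_finsetSum _ fun m _ => hint (Θ m), ← integral_const_mul]
    refine integral_mono_of_nonneg
      (Filter.Eventually.of_forall fun D => integral_nonneg fun _ => sq_nonneg _)
      ((integrable_finsetSum _ fun m _ => hint (Θ m)).const_mul _) ?_
    filter_upwards [ae_pi_sample ρ hY] with D hD
    have hi : ∀ m, Integrable (fun x => (μ x - treeOutput rule (Θ m) D x) ^ 2) ρ.fst := fun m =>
      integrable_sub_sq hμ.1 (hμ.ae_abs_le hY)
        ((hmeas (Θ m)).comp measurable_prodMk_left) (abs_treeOutput_le hB hD (Θ m))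
    unfold sqNorm
    rw [← integral_finsetSum _ fun m _ => hi m, ← integral_const_mul]
    refine integral_mono_of_nonneg (Filter.Eventually.of_forall fun _ => sq_nonneg _)
      ((integrable_finsetSum _ fun m _ => hi m).const_mul _)
      (Filter.Eventually.of_forall fun x => ?_)
    have e : μ x - forestOutput rule Θ D x =
        (M : ℝ)⁻¹ * ∑ m, (μ x - treeOutput rule (Θ m) D x) := by
      rw [Finset.sum_sub_distrib, mul_sub, forestOutput]
      simp only [Finset.sum_const, Finset.card_univ, Fintype.card_fin, nsmul_eq_mul]
      rw [inv_mul_cancel_left₀ hM0.ne']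
    change (μ x - forestOutput rule Θ D x) ^ 2 ≤
      (M : ℝ)⁻¹ * ∑ m, (μ x - treeOutput rule (Θ m) D x) ^ 2
    rw [e, mul_pow]
    have h1 := sq_sum_le_card_mul_sum_sq (s := Finset.univ)
      (f := fun m : Fin M => μ x - treeOutput rule (Θ m) D x)
    rw [Finset.card_univ, Fintype.card_fin] at h1
    calc _ ≤ ((M : ℝ)⁻¹) ^ 2 * (M * ∑ m, (μ x - treeOutput rule (Θ m) D x) ^ 2) := by gcongr
      _ = _ := by field_simp
  calc expectedRisk q K M rule ρ μ
      ≤ 𝔼 Θ : Fin M → Theta n p q K, (M : ℝ)⁻¹ * ∑ m, R (Θ m) :=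
        Finset.expect_le_expect fun Θ _ => hΘ Θ
    _ = 𝔼 θ, R θ := by
        rw [← Finset.mul_expect, Finset.expect_sum_comm]
        simp only [fun m : Fin M => expect_apply_coord m R]
        rw [Finset.sum_const, Finset.card_univ, Fintype.card_fin, nsmul_eq_mul,
          inv_mul_cancel_left₀ hM0.ne']

theorem expect_theta (F : (Fin n → Fin n) → Draws p q K → ℝ) :
    𝔼 θ : Theta n p q K, F θ.1 θ.2 = 𝔼 b, 𝔼 ξ, F b ξ := by
  rw [← Finset.expect_product' Finset.univ Finset.univ F]
  rfl

/-- The average over the draws of the risk of a tree that is grown on a given sample. -/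
theorem IsRegressionFunction.expect_sqNorm_sub_grow_le (hμ : IsRegressionFunction ρ μ) (hn : 0 < n)
    (hq : 1 ≤ q) (hqp : q ≤ p) (hK : 1 ≤ K) (hB : 0 < B) (hY : ∀ᵐ z ∂ρ, |z.2| ≤ B)
    (hrule : IsCART rule) {Z : Sample n p}
    (hmeas : ∀ ξ : Draws p q K, Measurable (grow rule Z K ξ Set.univ))
    (hZ : ∀ k, |(Z k).2| ≤ B)
    (hZs : ∀ k j, (Z k).1 j ∈ (ρ.fst.map fun x : Fin p → ℝ => x j).support)
    {g : (Fin p → ℝ) → ℝ} {f : Fin p → ℝ → ℝ} (hg : ∀ k, g (Z k).1 = ∑ j, f j ((Z k).1 j))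
    (hf : ∀ j, coordVariation ρ.fst j (f j) ≠ ⊤) {V : ℝ} (hVpos : 0 < V)
    (hV : ∑ j, (coordVariation ρ.fst j (f j)).toReal ≤ V)
    {ι : Type*} [Fintype ι] [Nonempty ι]
    {H E : ι → Set (Fin p → ℝ)} (hH : ∀ i, MeasurableSet (H i)) (hE : ∀ i, MeasurableSet (E i))
    (hEn : ∀ i, ρ.fst.real (E i) ≤ 1 / n)
    (hHE : ∀ c : Split p, ∃ i, ∀ x ∉ E i, (x c.1 ≤ c.2 ↔ x ∈ H i))
    {N₁ N₂ : ℝ} (hN₁ : 0 < N₁) (hN₂ : 0 < N₂) :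
    𝔼 ξ : Draws p q K, (sqNorm ρ.fst fun x => μ x - grow rule Z K ξ Set.univ x) ≤
      2 / n * ∑ k, excessLoss μ g (Z k) + 2 * (p / q * (V ^ 2 / (K + 3))) +
      (16 * B ^ 2 * 2 ^ K + 320 * B ^ 2 * (Real.log N₁ + expDeviation ρ μ (1 / (160 * B ^ 2))
        (treeClass H (leafGrid B n) K) Z / N₁ - 1) + 16 * B ^ 2 * 2 ^ K *
          (Real.log N₂ + expCount E Z / N₂ - 1)) / n := by
  have := nonempty_qSubset hqp
  have hn0 : (0 : ℝ) < n := by exact_mod_cast hn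
  have hFne : (treeClass H (leafGrid B n) K).Nonempty := by
    obtain ⟨w, hw, -⟩ := exists_mem_leafGrid hB hn (v := 0) (by simpa using hB.le)
    exact ⟨_, const_mem_treeClass hw K⟩
  have hmem : members Z Set.univ = Finset.univ := by ext; simp [mem_members]
  have h1 : ∀ ξ : Draws p q K, (sqNorm ρ.fst fun x => μ x - grow rule Z K ξ Set.univ x) ≤
      2 / n * (residualSS Z Set.univ (grow rule Z K ξ Set.univ) - residualSS Z Set.univ μ) +
      (16 * B ^ 2 * 2 ^ K + 320 * B ^ 2 * Real.log (expDeviation ρ μ (1 / (160 * B ^ 2))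
        (treeClass H (leafGrid B n) K) Z) + 16 * B ^ 2 * 2 ^ K * Real.log (expCount E Z)) / n := by
    intro ξ
    rw [residualSS_sub_residualSS]
    exact hμ.sqNorm_sub_grow_le hB hY hn hH hE hEn hHE rule hZ ξ (hmeas ξ)
  refine (Finset.expect_le_expect fun ξ _ => h1 ξ).trans ?_
  rw [Finset.expect_add_distrib, Fintype.expect_const, ← Finset.mul_expect,
    Finset.expect_sub_distrib, Fintype.expect_const]
  have h2 := meanSS_le (Z := Z) hrule hq hqp f
    (fun j => (ρ.fst.map fun x : Fin p → ℝ => x j).support) hZs hf hVpos hV hK Set.univ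
  have h3 : residualSS Z Set.univ (fun x => ∑ j, f j (x j)) = residualSS Z Set.univ g :=
    Finset.sum_congr rfl fun k _ => by rw [hg k]
  have h4 : (count Z Set.univ : ℝ) = n := by simp [count, hmem]
  rw [h3, h4] at h2
  change (𝔼 ξ : Draws p q K, residualSS Z Set.univ (grow rule Z K ξ Set.univ)) ≤ _ at h2
  have h5 := residualSS_sub_residualSS (μ := μ) Z g
  have h6 : 2 / (n : ℝ) * ((𝔼 ξ : Draws p q K, residualSS Z Set.univ
      (grow rule Z K ξ Set.univ)) - residualSS Z Set.univ μ) ≤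
      2 / n * ∑ k, excessLoss μ g (Z k) + 2 * (p / q * (V ^ 2 / (K + 3))) := by
    calc _ ≤ 2 / (n : ℝ) * (∑ k, excessLoss μ g (Z k) + n * (p / q * (V ^ 2 / (K + 3)))) :=
          mul_le_mul_of_nonneg_left (by linarith) (by positivity)
      _ = _ := by field_simp
  have p1 : 0 < expDeviation ρ μ (1 / (160 * B ^ 2)) (treeClass H (leafGrid B n) K) Z :=
    Finset.sum_pos (fun _ _ => by positivity) hFne
  have p2 : 0 < expCount E Z := Finset.sum_pos (fun _ _ => by positivity) Finset.univ_nonempty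
  have l1 := mul_le_mul_of_nonneg_left (log_le_log_add_div hN₁ p1)
    (by positivity : 0 ≤ 320 * B ^ 2)
  have l2 := mul_le_mul_of_nonneg_left (log_le_log_add_div hN₂ p2)
    (by positivity : 0 ≤ 16 * B ^ 2 * 2 ^ K)
  refine add_le_add h6 (div_le_div_of_nonneg_right ?_ hn0.le)
  linarith

/-- The bound for the risk of a forest before the deviation terms are simplified. -/
theorem expectedRisk_le {M : ℕ} (hn : 0 < n) (hq : 1 ≤ q) (hqp : q ≤ p) (hK : 1 ≤ K) (hM : 1 ≤ M)
    (hB : 0 < B) (hY : ∀ᵐ z ∂ρ, |z.2| ≤ B) (hμ : IsRegressionFunction ρ μ) (hrule : IsCART rule)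
    (hmeas : ∀ θ : Theta n p q K,
      Measurable fun z : Sample n p × (Fin p → ℝ) => treeOutput rule θ z.1 z.2)
    {g : (Fin p → ℝ) → ℝ} {f : Fin p → ℝ → ℝ} (hg : IsAdditiveRep ρ.fst g f)
    (hf : ∀ j, coordVariation ρ.fst j (f j) ≠ ⊤) {V : ℝ} (hVpos : 0 < V)
    (hV : ∑ j, (coordVariation ρ.fst j (f j)).toReal ≤ V)
    {ι : Type*} [Fintype ι] [Nonempty ι]
    {H E : ι → Set (Fin p → ℝ)} (hH : ∀ i, MeasurableSet (H i)) (hE : ∀ i, MeasurableSet (E i))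
    (hEn : ∀ i, ρ.fst.real (E i) ≤ 1 / n)
    (hHE : ∀ c : Split p, ∃ i, ∀ x ∉ E i, (x c.1 ≤ c.2 ↔ x ∈ H i)) :
    expectedRisk q K M rule ρ μ ≤ 2 * (sqNorm ρ.fst fun x => μ x - g x) +
      2 * (p / q * (V ^ 2 / (K + 3))) +
      (16 * B ^ 2 * 2 ^ K + 320 * B ^ 2 * Real.log (treeClass H (leafGrid B n) K).card +
        16 * B ^ 2 * 2 ^ K *
          Real.log (Fintype.card ι * Real.exp (Real.exp (Real.exp 1 - 1) - 1))) / n := by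
  have := nonempty_qSubset hqp
  have : NeZero n := ⟨hn.ne'⟩
  have hn0 : (0 : ℝ) < n := by exact_mod_cast hn
  refine (expectedRisk_le_expect hM hn hqp hB.le hY hμ hmeas).trans ?_
  set F := treeClass H (leafGrid B n) K
  set c := 1 / (160 * B ^ 2) with hc
  set N₁ : ℝ := (F.card : ℝ)
  set N₂ : ℝ := Fintype.card ι * Real.exp (Real.exp (Real.exp 1 - 1) - 1)
  have hFne : F.Nonempty := by
    obtain ⟨w, hw, -⟩ := exists_mem_leafGrid hB hn (v := 0) (by simpa using hB.le)
    exact ⟨_, const_mem_treeClass hw K⟩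
  have hN₁ : 0 < N₁ := Nat.cast_pos.2 hFne.card_pos
  have hN₂ : 0 < N₂ := by
    have : (0 : ℝ) < Fintype.card ι := by exact_mod_cast Fintype.card_pos
    positivity
  obtain ⟨iW₁, hW₁⟩ := hμ.integral_expDeviation_le hB hY hn
    (F := F) (measurable_of_mem_treeClass hH)
    (abs_le_of_mem_treeClass fun w hw => abs_le_of_mem_leafGrid hB hn hw)
  obtain ⟨iW₂, hW₂⟩ := integral_expCount_le (ρ := ρ) hn hE hEn
  set w₁ : Sample n p → ℝ := fun D => 𝔼 b : Fin n → Fin n, expDeviation ρ μ c F fun k => D (b k)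
    with hw₁
  set w₂ : Sample n p → ℝ := fun D => 𝔼 b : Fin n → Fin n, expCount E fun k => D (b k) with hw₂
  obtain ⟨hgm, A, hgA⟩ := aemeasurable_of_isAdditiveRep hg hf
  obtain ⟨ig, hgint⟩ := hμ.integral_excessLoss hY hgm hgA
  -- the pointwise bound
  have hm : ∀ j : Fin p, Measurable fun x : Fin p → ℝ => x j := fun j => measurable_pi_apply j
  have hsupp : ∀ᵐ z ∂ρ, ∀ j, z.1 j ∈ (ρ.fst.map fun x : Fin p → ℝ => x j).support :=
    ae_of_ae_fst (ae_all_iff.2 fun j => ae_of_ae_map (hm j).aemeasurable Measure.support_mem_ae)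
  have hpt : ∀ᵐ D : Sample n p ∂(Measure.pi fun _ => ρ),
      𝔼 θ : Theta n p q K, (sqNorm ρ.fst fun x => μ x - treeOutput rule θ D x) ≤
        2 / n * ∑ i, excessLoss μ g (D i) + 2 * (p / q * (V ^ 2 / (K + 3))) +
        (16 * B ^ 2 * 2 ^ K + 320 * B ^ 2 * (Real.log N₁ + w₁ D / N₁ - 1) +
          16 * B ^ 2 * 2 ^ K * (Real.log N₂ + w₂ D / N₂ - 1)) / n := by
    filter_upwards [ae_pi_sample ρ hY, ae_pi_sample ρ hsupp, ae_pi_sample ρ (ae_of_ae_fst hg)]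
      with D hD1 hD2 hD3
    rw [expect_theta fun b ξ => sqNorm ρ.fst fun x => μ x - treeOutput rule (b, ξ) D x]
    have hb := fun b : Fin n → Fin n => hμ.expect_sqNorm_sub_grow_le (q := q) (K := K)
      (Z := fun k => D (b k)) hn hq hqp hK hB hY hrule
      (fun ξ => (hmeas (b, ξ)).comp (measurable_prodMk_left (x := D))) (fun k => hD1 (b k))
      (fun k => hD2 (b k)) (fun k => hD3 (b k)) hf hVpos hV hH hE hEn hHE hN₁ hN₂
    -- The bound is affine in the bootstrap quantities. Each bootstrap index is uniform, so the mean
    -- of the resampled excess loss of g is its sum over D.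
    refine (Finset.expect_le_expect fun b _ => hb b).trans_eq ?_
    simp only [Finset.expect_add_distrib, Finset.expect_sub_distrib, ← Finset.mul_expect,
      ← Finset.expect_div, Fintype.expect_const, expect_sum_bootstrap hn, hw₁, hw₂]
    rfl
  have igi : ∀ i, Integrable (fun D : Sample n p => excessLoss μ g (D i)) (Measure.pi fun _ => ρ) :=
    fun i => (measurePreserving_eval (fun _ : Fin n => ρ) i).integrable_comp_of_integrable ig
  have iG : Integrable (fun D : Sample n p => ∑ i, excessLoss μ g (D i))
      (Measure.pi fun _ => ρ) := integrable_finsetSum _ fun i _ => igi i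
  have hG : ∫ D : Sample n p, ∑ i, excessLoss μ g (D i) ∂(Measure.pi fun _ => ρ) =
      n * sqNorm ρ.fst fun x => μ x - g x := by
    rw [integral_finsetSum _ fun i _ => igi i]
    have : ∀ i : Fin n, ∫ D : Sample n p, excessLoss μ g (D i) ∂(Measure.pi fun _ => ρ) =
        sqNorm ρ.fst fun x => μ x - g x := by
      intro i
      rw [← hgint]
      exact integral_comp_eval (μ := fun _ : Fin n => ρ) ig.aestronglyMeasurable
    simp [this]
  have iL₁ : Integrable (fun D => 320 * B ^ 2 * (Real.log N₁ + w₁ D / N₁ - 1))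
      (Measure.pi fun _ : Fin n => ρ) :=
    (((integrable_const _).add (iW₁.div_const _)).sub (integrable_const _)).const_mul _
  have iL₂ : Integrable (fun D => 16 * B ^ 2 * 2 ^ K * (Real.log N₂ + w₂ D / N₂ - 1))
      (Measure.pi fun _ : Fin n => ρ) :=
    (((integrable_const _).add (iW₂.div_const _)).sub (integrable_const _)).const_mul _
  have hint : ∀ θ : Theta n p q K, _ := fun θ =>
    integrable_sqNorm_sub_treeOutput hB.le hY hμ θ (hmeas θ)
  have hswap : 𝔼 θ : Theta n p q K,
      ∫ D : Sample n p, sqNorm ρ.fst (fun x => μ x - treeOutput rule θ D x)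
        ∂(Measure.pi fun _ => ρ) = ∫ D : Sample n p, 𝔼 θ : Theta n p q K,
          (sqNorm ρ.fst fun x => μ x - treeOutput rule θ D x) ∂(Measure.pi fun _ => ρ) := by
    simp only [Fintype.expect_eq_sum_div_card]
    rw [integral_div, integral_finsetSum _ fun θ _ => hint θ]
  rw [hswap]
  have iA : Integrable (fun D : Sample n p => 2 / n * ∑ i, excessLoss μ g (D i) +
      2 * (p / q * (V ^ 2 / (K + 3)))) (Measure.pi fun _ => ρ) :=
    (iG.const_mul _).add (integrable_const _)
  have iC : Integrable (fun D : Sample n p => 16 * B ^ 2 * 2 ^ K +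
      320 * B ^ 2 * (Real.log N₁ + w₁ D / N₁ - 1)) (Measure.pi fun _ => ρ) :=
    (integrable_const _).add iL₁
  have iR : Integrable (fun D : Sample n p => (16 * B ^ 2 * 2 ^ K +
      320 * B ^ 2 * (Real.log N₁ + w₁ D / N₁ - 1) +
      16 * B ^ 2 * 2 ^ K * (Real.log N₂ + w₂ D / N₂ - 1)) / n) (Measure.pi fun _ => ρ) :=
    (iC.add iL₂).div_const _
  refine (integral_mono_of_nonneg (Filter.Eventually.of_forall fun D =>
    Finset.expect_nonneg fun θ _ => integral_nonneg fun _ => sq_nonneg _)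
    (iA.add iR) hpt).trans ?_
  have iV₁ : Integrable (fun D => Real.log N₁ + w₁ D / N₁) (Measure.pi fun _ : Fin n => ρ) :=
    (integrable_const _).add (iW₁.div_const _)
  have iV₂ : Integrable (fun D => Real.log N₂ + w₂ D / N₂) (Measure.pi fun _ : Fin n => ρ) :=
    (integrable_const _).add (iW₂.div_const _)
  have e1 : ∫ D, 320 * B ^ 2 * (Real.log N₁ + w₁ D / N₁ - 1) ∂(Measure.pi fun _ : Fin n => ρ) ≤
      320 * B ^ 2 * Real.log N₁ := by
    rw [integral_const_mul, integral_sub iV₁ (integrable_const _),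
      integral_add (integrable_const _) (iW₁.div_const _), integral_div]
    simp only [integral_const, probReal_univ, smul_eq_mul, one_mul, mul_one]
    have : (∫ D, w₁ D ∂(Measure.pi fun _ : Fin n => ρ)) / N₁ ≤ 1 := (div_le_one hN₁).2 hW₁
    gcongr
    linarith
  have e2 : ∫ D, 16 * B ^ 2 * 2 ^ K * (Real.log N₂ + w₂ D / N₂ - 1)
      ∂(Measure.pi fun _ : Fin n => ρ) ≤ 16 * B ^ 2 * 2 ^ K * Real.log N₂ := by
    rw [integral_const_mul, integral_sub iV₂ (integrable_const _),
      integral_add (integrable_const _) (iW₂.div_const _), integral_div]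
    simp only [integral_const, probReal_univ, smul_eq_mul, one_mul, mul_one]
    have : (∫ D, w₂ D ∂(Measure.pi fun _ : Fin n => ρ)) / N₂ ≤ 1 := (div_le_one hN₂).2 hW₂
    gcongr
    linarith
  rw [integral_add' iA iR, integral_add (iG.const_mul _) (integrable_const _), integral_const_mul,
    hG, integral_div, integral_add iC iL₂, integral_add (integrable_const _) iL₁]
  simp only [integral_const, probReal_univ, smul_eq_mul, one_mul]
  have e3 : 2 / (n : ℝ) * (n * sqNorm ρ.fst fun x => μ x - g x) =
      2 * sqNorm ρ.fst fun x => μ x - g x := by field_simp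
  rw [e3]
  gcongr

end Risk

/-! ### Cardinalities, constants and the infimum -/

theorem one_le_two_mul_log {N : ℝ} (hN : 2 ≤ N) : 1 ≤ 2 * Real.log N := by
  have h1 := Real.log_le_log two_pos hN
  have h2 := Real.log_two_gt_d9
  linarith

theorem log_card_grid_le {n p : ℕ} (hnp : 2 ≤ n * p) :
    Real.log (Fintype.card (Fin p × Fin (n + 1))) ≤ 2 * Real.log (n * p) := by
  have hn : 1 ≤ n := Nat.pos_of_ne_zero (by rintro rfl; omega)
  have hp : 1 ≤ p := Nat.pos_of_ne_zero (by rintro rfl; omega)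
  have h1 : Fintype.card (Fin p × Fin (n + 1)) ≤ (n * p) ^ 2 := by
    simp only [Fintype.card_prod, Fintype.card_fin]
    nlinarith
  have h2 : 0 < Fintype.card (Fin p × Fin (n + 1)) := by
    simp only [Fintype.card_prod, Fintype.card_fin]
    positivity
  calc _ ≤ Real.log (((n : ℝ) * p) ^ 2) :=
        Real.log_le_log (by exact_mod_cast h2) (by exact_mod_cast h1)
    _ = _ := by rw [Real.log_pow]; norm_num

/-- The exponent 5 is 2 for the number p(n + 1) of grid splits plus 3 for the 2n + 1 leaf values;
both comparisons with powers of np use np ≥ 2. -/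
theorem log_card_treeClass_le {n p : ℕ} (hnp : 2 ≤ n * p) {X : Type*}
    (H : Fin p × Fin (n + 1) → Set X) {B : ℝ} (K : ℕ) :
    Real.log (treeClass H (leafGrid B n) K).card ≤ 2 ^ K * (5 * Real.log (n * p)) := by
  have hn : 1 ≤ n := Nat.pos_of_ne_zero (by rintro rfl; omega)
  have hp : 1 ≤ p := Nat.pos_of_ne_zero (by rintro rfl; omega)
  have hlog : 0 ≤ Real.log ((n : ℝ) * p) :=
    Real.log_nonneg (by exact_mod_cast (by omega : 1 ≤ n * p))
  rcases Nat.eq_zero_or_pos (treeClass H (leafGrid B n) K).card with h0 | hpos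
  · rw [h0, Nat.cast_zero, Real.log_zero]
    positivity
  have hι : Fintype.card (Fin p × Fin (n + 1)) ≤ (n * p) ^ 2 := by
    simp only [Fintype.card_prod, Fintype.card_fin]
    nlinarith
  have hι' : 1 ≤ Fintype.card (Fin p × Fin (n + 1)) := by
    simp only [Fintype.card_prod, Fintype.card_fin]
    nlinarith
  have hL : (leafGrid B n).card ≤ (n * p) ^ 3 := by
    refine (card_leafGrid_le B n).trans ?_
    have h2 : n ≤ n * p := Nat.le_mul_of_pos_right n hp
    calc 2 * n + 1 ≤ 2 ^ 2 * (n * p) := by omega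
      _ ≤ (n * p) ^ 2 * (n * p) := Nat.mul_le_mul_right _ (Nat.pow_le_pow_left hnp 2)
      _ = (n * p) ^ 3 := by ring
  have h1 : (treeClass H (leafGrid B n) K).card ≤ ((n * p) ^ 5) ^ 2 ^ K := by
    calc _ ≤ (treeClass H (leafGrid B n) K).card * Fintype.card (Fin p × Fin (n + 1)) :=
          Nat.le_mul_of_pos_right _ hι'
      _ ≤ (Fintype.card (Fin p × Fin (n + 1)) * (leafGrid B n).card) ^ 2 ^ K :=
          card_treeClass_le H _ K
      _ ≤ ((n * p) ^ 2 * (n * p) ^ 3) ^ 2 ^ K := Nat.pow_le_pow_left (Nat.mul_le_mul hι hL) _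
      _ = _ := by rw [← pow_add]
  calc _ ≤ Real.log ((((n : ℝ) * p) ^ 5) ^ 2 ^ K) :=
        Real.log_le_log (by exact_mod_cast hpos) (by exact_mod_cast h1)
    _ = _ := by rw [Real.log_pow, Real.log_pow]; push_cast; ring

theorem zero_mem_additiveBV {p : ℕ} (P : Measure (Fin p → ℝ)) : (fun _ => 0) ∈ additiveBV P := by
  refine ⟨fun _ _ => 0, ?_, fun j => ?_⟩
  · simp [IsAdditiveRep]
  · rw [coordVariation, eVariationOn.constant_on]
    · exact ENNReal.zero_ne_top
    · rintro _ ⟨_, _, rfl⟩ _ ⟨_, _, rfl⟩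
      rfl

/-- The infimum that defines `tvNorm` need not be attained, hence the slack V. Membership in the
class makes it finite, so `toReal` loses nothing. -/
theorem exists_isAdditiveRep_lt {p : ℕ} {P : Measure (Fin p → ℝ)} {g : (Fin p → ℝ) → ℝ}
    (hg : g ∈ additiveBV P) {V : ℝ} (hV : tvNorm P g < V) :
    ∃ f : Fin p → ℝ → ℝ, IsAdditiveRep P g f ∧ (∀ j, coordVariation P j (f j) ≠ ⊤) ∧
      ∑ j, (coordVariation P j (f j)).toReal ≤ V := by
  obtain ⟨f₀, hf₀, hf₀v⟩ := hg
  have hne : (⨅ (f : Fin p → ℝ → ℝ) (_ : IsAdditiveRep P g f), ∑ j, coordVariation P j (f j)) ≠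
      ⊤ := ne_top_of_le_ne_top (ENNReal.sum_ne_top.2 fun j _ => hf₀v j) (iInf₂_le f₀ hf₀)
  have hlt := (ENNReal.lt_ofReal_iff_toReal_lt hne).2 hV
  obtain ⟨f, hf⟩ := iInf_lt_iff.1 hlt
  obtain ⟨hrep, hf⟩ := iInf_lt_iff.1 hf
  have hfin : ∀ j, coordVariation P j (f j) ≠ ⊤ := fun j =>
    ENNReal.sum_ne_top.1 (hf.trans ENNReal.ofReal_lt_top).ne j (Finset.mem_univ j)
  refine ⟨f, hrep, hfin, ?_⟩
  rw [← ENNReal.toReal_sum fun j _ => hfin j]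
  exact ENNReal.toReal_le_of_le_ofReal (ENNReal.toReal_nonneg.trans hV.le) hf.le

end RandomForest

theorem mainTheorem3 (B : ℝ) (hB : 0 < B) :
    ∃ C : ℝ, 0 < C ∧
      ∀ (n p q K M : ℕ) (_ : 2 ≤ n * p) (_ : 1 ≤ q) (_ : q ≤ p) (_ : 1 ≤ K) (_ : 1 ≤ M)
        (ρ : Measure ((Fin p → ℝ) × ℝ)) (_ : IsProbabilityMeasure ρ)
        (_ : ∀ᵐ z ∂ρ, |z.2| ≤ B)
        (μ : (Fin p → ℝ) → ℝ) (_ : RandomForest.IsRegressionFunction ρ μ)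
        (rule : RandomForest.SplitRule n p) (_ : RandomForest.IsCART rule)
        (_ : ∀ θ : RandomForest.Theta n p q K,
          Measurable fun z : RandomForest.Sample n p × (Fin p → ℝ) =>
            RandomForest.treeOutput rule θ z.1 z.2),
        RandomForest.expectedRisk q K M rule ρ μ ≤
          2 * ⨅ g : RandomForest.additiveBV ρ.fst,
            (RandomForest.sqNorm ρ.fst (fun x => μ x - (g : (Fin p → ℝ) → ℝ) x) +
              (p / q : ℝ) * (RandomForest.tvNorm ρ.fst g ^ 2 / (K + 3)) +
              C * (2 ^ K * Real.log (n * p) / n)) := by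
  set γ := Real.exp (Real.exp 1 - 1) - 1 with hγ
  have hγ0 : 0 ≤ γ := by
    have h1 := Real.add_one_le_exp (1 : ℝ)
    have h2 := Real.add_one_le_exp (Real.exp 1 - 1)
    linarith
  -- The deviation terms add up to 32 + 1600 + 32(1 + γ) times B² 2^K log(np)/n; half of this
  -- remains after the factor 2 is taken out.
  refine ⟨B ^ 2 * (832 + 16 * γ), by positivity, ?_⟩
  intro n p q K M hnp hq hqp hK hM ρ _ hY μ hμ rule hrule hmeas
  have hn : 0 < n := Nat.pos_of_ne_zero (by rintro rfl; omega)
  have hp : 0 < p := by omega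
  have hn0 : (0 : ℝ) < n := by exact_mod_cast hn
  have : Nonempty (RandomForest.additiveBV ρ.fst) := ⟨⟨_, RandomForest.zero_mem_additiveBV _⟩⟩
  rw [← div_le_iff₀' two_pos]
  refine le_ciInf fun g => ?_
  rw [div_le_iff₀' two_pos]
  obtain ⟨H, E, hH, hE, hEn, hHE⟩ := RandomForest.exists_split_grid ρ.fst hn
  have : Nonempty (Fin p × Fin (n + 1)) := ⟨(⟨0, hp⟩, 0)⟩
  set L := Real.log ((n : ℝ) * p)
  have hL : 1 ≤ 2 * L := RandomForest.one_le_two_mul_log (by exact_mod_cast hnp)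
  have hdev : (16 * B ^ 2 * 2 ^ K + 320 * B ^ 2 *
      Real.log (RandomForest.treeClass H (RandomForest.leafGrid B n) K).card + 16 * B ^ 2 * 2 ^ K *
        Real.log (Fintype.card (Fin p × Fin (n + 1)) * Real.exp γ)) / n ≤
      2 * (B ^ 2 * (832 + 16 * γ) * (2 ^ K * L / n)) := by
    have h1 := RandomForest.log_card_treeClass_le hnp H (B := B) K
    have h2 := RandomForest.log_card_grid_le hnp
    have h3 : Real.log (Fintype.card (Fin p × Fin (n + 1)) * Real.exp γ) ≤ 2 * L + γ * (2 * L) := by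
      rw [Real.log_mul (by exact_mod_cast Fintype.card_ne_zero) (Real.exp_pos γ).ne', Real.log_exp]
      exact add_le_add h2 (le_mul_of_one_le_right hγ0 hL)
    have h4 : 16 * B ^ 2 * 2 ^ K ≤ 16 * B ^ 2 * 2 ^ K * (2 * L) :=
      le_mul_of_one_le_right (by positivity) hL
    calc _ ≤ (16 * B ^ 2 * 2 ^ K * (2 * L) + 320 * B ^ 2 * (2 ^ K * (5 * L)) +
          16 * B ^ 2 * 2 ^ K * (2 * L + γ * (2 * L))) / n := by
          refine div_le_div_of_nonneg_right ?_ hn0.le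
          exact add_le_add (add_le_add h4 (mul_le_mul_of_nonneg_left h1 (by positivity)))
            (mul_le_mul_of_nonneg_left h3 (by positivity))
      _ = _ := by ring
  have hbound : ∀ V, RandomForest.tvNorm ρ.fst g < V → RandomForest.expectedRisk q K M rule ρ μ ≤
      2 * (RandomForest.sqNorm ρ.fst (fun x => μ x - (g : (Fin p → ℝ) → ℝ) x) +
        (p / q : ℝ) * (V ^ 2 / (K + 3)) + B ^ 2 * (832 + 16 * γ) * (2 ^ K * L / n)) := by
    intro V hV
    obtain ⟨f, hrep, hfin, hfV⟩ := RandomForest.exists_isAdditiveRep_lt g.2 hV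
    have hVpos : 0 < V := lt_of_le_of_lt ENNReal.toReal_nonneg hV
    have h := RandomForest.expectedRisk_le hn hq hqp hK hM hB hY hμ hrule hmeas hrep hfin hVpos hfV
      hH hE hEn hHE
    linarith
  -- The bound holds for every V strictly above the total variation norm, which also ensures V > 0;
  -- letting V decrease to the norm covers the case where it is zero or not attained.
  have hcont : Continuous fun V : ℝ =>
      2 * (RandomForest.sqNorm ρ.fst (fun x => μ x - (g : (Fin p → ℝ) → ℝ) x) +
        (p / q : ℝ) * (V ^ 2 / (K + 3)) + B ^ 2 * (832 + 16 * γ) * (2 ^ K * L / n)) := by fun_prop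
  exact ge_of_tendsto (hcont.continuousAt.tendsto.mono_left nhdsWithin_le_nhds)
    (Filter.eventually_of_mem (self_mem_nhdsWithin (s := Set.Ioi (RandomForest.tvNorm ρ.fst g)))
      hbound)
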